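/- Let $G$ be a finite simple graph with $n\ge 1$ vertices, none of them isolated, let $K$ be a field, and let $S=K[x_1,\dots,x_n]$ with irrelevant ideal $\mathfrak m=(x_1,\dots,x_n)$. For an integer $k\ge 0$, a $k$-cover of $G$ is a nonzero vector $a\in\mathbb N^n$ (where $0\in\mathbb N$) such that $a_i+a_j\ge k$ for every edge $\{i,j\}$ of $G$. A $k$-cover is basic if it is not the sum of a $k$-cover and a $0$-cover. The norm of $a$ is $\sum_i a_i$. The graph $G$ is unmixed if all basic $1$-covers of $G$ have the same number of ones. The graph $G$ is a domain if for all integers $s,t\ge 0$, not both zero, the sum of any $s$ basic $1$-covers and any $t$ basic $2$-covers of $G$ is a basic $(s+2t)$-cover. Let $G^{0-1}$ be the graph on the vertices of $G$ whose edges are those edges $\{i,j\}$ of $G$ such that $a_i+a_j=1$ for every basic $1$-cover $a$ of $G$. The graph $G$ satisfies the matching square condition (MSC) if it has a perfect matching such that for each edge $\{i,j\}$ of the matching and all edges $\{i,i'\}$ and $\{j,j'\}$ of $G$, also $\{i',j'\}$ is an edge of $G$. Let $I(G)\subseteq S$ be the ideal generated by the monomials $x_ix_j$ with $\{i,j\}$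 an edge of $G$, let $J(G)=\bigcap_{\{i,j\}}(x_i,x_j)$, the intersection being over all edges of $G$, and let $J(G)^{(k)}$ be the $k$-th symbolic power of $J(G)$. Put $R_s(J(G))=\bigoplus_{k\ge 0}J(G)^{(k)}$ (the symbolic Rees algebra) and $\bar A(G)=R_s(J(G))/\mathfrak m R_s(J(G))$. An ideal is unmixed if all its associated primes have the same height. Theorem. The following are equivalent: 1. $G$ satisfies MSC; 2. for every $k\ge 1$, every basic $k$-cover of $G$ has norm $\frac{kn}{2}$; 3. for every $k\ge 1$, all basic $k$-covers of $G$ have the same norm; 4. $G$ is unmixed and $G$ is a domain; 5. $\bar A(G)$ is an integral domain and $I(G)$ is unmixed; 6. every connected component of $G^{0-1}$ is a complete bipartite graph $K_{a,a}$ for some integer $a\ge 1$ (which may depend on the component); 7. $G^{0-1}$ has a perfect matching; 8. $G$ has a perfect matching and every basic $1$-cover of $G$ has exactly $\frac n2$ ones. -/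

import Mathlib

namespace BasicCovers

/-! ### Covers of graphs -/

section Covers

/-- A `k`-cover of `G`: a nonzero vector of natural numbers on the vertices such that
the two ends of every edge have sum at least `k`. -/
def IsCover {V : Type*} (G : SimpleGraph V) (k : ℕ) (a : V → ℕ) : Prop :=
  a ≠ 0 ∧ ∀ i j : V, G.Adj i j → k ≤ a i + a j

/-- A `k`-cover is basic if it is not the sum of a `k`-cover and a `0`-cover. -/
def IsBasicCover {V : Type*} (G : SimpleGraph V) (k : ℕ) (a : V → ℕ) : Prop :=
  IsCover G k a ∧ ¬ ∃ b c : V → ℕ, IsCover G k b ∧ IsCover G 0 c ∧ a = b + c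

/-- The norm of a cover is the sum of its entries. -/
def norm {V : Type*} [Fintype V] (a : V → ℕ) : ℕ := ∑ i, a i

/-- The number of ones of a cover. -/
def numOnes {V : Type*} [Fintype V] (a : V → ℕ) : ℕ :=
  (Finset.univ.filter fun i => a i = 1).card

/-- `G` is unmixed if all its basic `1`-covers have the same number of ones. -/
def IsUnmixedGraph {V : Type*} [Fintype V] (G : SimpleGraph V) : Prop :=
  ∀ a b : V → ℕ, IsBasicCover G 1 a → IsBasicCover G 1 b → numOnes a = numOnes b

/-- `G` is a domain if any `s` basic `1`-covers and any `t` basic `2`-covers (not necessarily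
distinct) add up to a basic `(s + 2 t)`-cover. The empty sum `s = t = 0` is left out: it is the
zero vector, which is not a cover. -/
def IsDomainGraph {V : Type*} (G : SimpleGraph V) : Prop :=
  ∀ s t : ℕ, 0 < s + t → ∀ (a : Fin s → V → ℕ) (b : Fin t → V → ℕ),
    (∀ p, IsBasicCover G 1 (a p)) → (∀ q, IsBasicCover G 2 (b q)) →
      IsBasicCover G (s + 2 * t) (∑ p, a p + ∑ q, b q)

end Covers

/-! ### The matching square condition and the graph `G^{0-1}` -/

section Graphs

/-- `G^red`: the graph obtained from `G` by deleting all isolated vertices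
(`G.support` is the set of non-isolated vertices). -/
def red {V : Type*} (G : SimpleGraph V) : SimpleGraph G.support := G.induce G.support

/-- The matching square condition: `G^red` is nonempty and has a perfect matching such that, for
each edge `{i, j}` of the matching and all edges `{i, i'}` and `{j, j'}` of `G`,
`{i', j'}` is an edge of `G`. -/
def MSC {V : Type*} (G : SimpleGraph V) : Prop :=
  Nonempty G.support ∧ ∃ M : (red G).Subgraph, M.IsPerfectMatching ∧
    ∀ i j : G.support, M.Adj i j → ∀ i' j' : V, G.Adj i i' → G.Adj j j' → G.Adj i' j'

/-- `G^{0-1}`: the vertices are those of `G^red`, the edges are the edges `{i, j}` of `G` with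
`a i + a j = 1` for every basic `1`-cover `a` of `G`. -/
def zeroOneGraph {V : Type*} (G : SimpleGraph V) : SimpleGraph G.support where
  Adj i j := G.Adj i j ∧ ∀ a : V → ℕ, IsBasicCover G 1 a → a i + a j = 1
  symm := ⟨fun i j h => ⟨h.1.symm, fun a ha => by rw [add_comm]; exact h.2 a ha⟩⟩
  loopless := ⟨fun i h => G.loopless.irrefl _ h.1⟩

end Graphs

/-! ### Symbolic powers, symbolic Rees algebra and unmixed ideals -/

section Algebra

/-- The `k`-th symbolic power `⋂_P (I^k R_P ∩ R)`, where `P` runs through the minimal primes of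
`I`. For a radical ideal of a Noetherian ring, such as a cover ideal, these are the associated
primes of `I`. -/
def symbolicPower {R : Type*} [CommRing R] (I : Ideal R) (k : ℕ) : Ideal R :=
  ⨅ P : {P : PrimeSpectrum R // P.asIdeal ∈ I.minimalPrimes},
    ((I ^ k).map (algebraMap R (Localization.AtPrime P.1.asIdeal))).comap
      (algebraMap R (Localization.AtPrime P.1.asIdeal))

theorem symbolicPower_zero {R : Type*} [CommRing R] (I : Ideal R) : symbolicPower I 0 = ⊤ := by
  simp [symbolicPower, Ideal.one_eq_top, Ideal.map_top]

theorem mul_mem_symbolicPower {R : Type*} [CommRing R] (I : Ideal R) {k l : ℕ} {x y : R}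
    (hx : x ∈ symbolicPower I k) (hy : y ∈ symbolicPower I l) :
    x * y ∈ symbolicPower I (k + l) := by
  simp only [symbolicPower, Ideal.mem_iInf, Ideal.mem_comap] at hx hy ⊢
  intro P
  rw [map_mul, pow_add, Ideal.map_mul]
  exact Ideal.mul_mem_mul (hx P) (hy P)

/-- The symbolic Rees algebra `⨁ I^{(k)} t^k`, as a subalgebra of `R[t]`. -/
def symbolicReesAlgebra {R : Type*} [CommRing R] (I : Ideal R) :
    Subalgebra R (Polynomial R) where
  carrier := {f | ∀ k, f.coeff k ∈ symbolicPower I k}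
  mul_mem' := by
    intro f g hf hg k
    rw [Polynomial.coeff_mul]
    refine Ideal.sum_mem _ ?_
    rintro ⟨i, j⟩ e
    rw [← Finset.HasAntidiagonal.mem_antidiagonal.mp e]
    exact mul_mem_symbolicPower I (hf i) (hg j)
  add_mem' := by
    intro f g hf hg k
    rw [Polynomial.coeff_add]
    exact Ideal.add_mem _ (hf k) (hg k)
  algebraMap_mem' := by
    intro r k
    rw [Polynomial.algebraMap_apply, Polynomial.coeff_C]
    split_ifs with h
    · subst h
      simp [symbolicPower_zero]
    · simp

/-- An ideal is unmixed if all its associated primes (the associated primes of `R ⧸ I`)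
have the same height. -/
def IsUnmixedIdeal {R : Type*} [CommRing R] (I : Ideal R) : Prop :=
  ∀ P ∈ associatedPrimes R (R ⧸ I), ∀ Q ∈ associatedPrimes R (R ⧸ I), P.height = Q.height

end Algebra

/-! ### The ideals and the algebra attached to a graph -/

section GraphIdeals

/-- The edge ideal `I(G)`, generated by the monomials `x_i x_j` with `{i, j}` an edge. -/
noncomputable def edgeIdeal (K : Type*) [Field K] {V : Type*} (G : SimpleGraph V) :
    Ideal (MvPolynomial V K) :=
  Ideal.span {f | ∃ i j : V, G.Adj i j ∧ f = MvPolynomial.X i * MvPolynomial.X j}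

/-- The cover ideal `J(G)`, the intersection of the ideals `(x_i, x_j)` with `{i, j}` an edge. -/
noncomputable def coverIdeal (K : Type*) [Field K] {V : Type*} (G : SimpleGraph V) :
    Ideal (MvPolynomial V K) :=
  ⨅ e : {e : V × V // G.Adj e.1 e.2},
    Ideal.span {MvPolynomial.X e.1.1, MvPolynomial.X e.1.2}

/-- The irrelevant ideal of the polynomial ring, generated by the variables. -/
noncomputable def irrelevantIdeal (K : Type*) [Field K] (V : Type*) :
    Ideal (MvPolynomial V K) :=
  Ideal.span (Set.range MvPolynomial.X)

/-- The basic covers algebra `Ā(G) = R_s(J(G)) / 𝔪 R_s(J(G))`, the symbolic fiber cone of the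
cover ideal. -/
abbrev basicCoversAlgebra (K : Type*) [Field K] {V : Type*} (G : SimpleGraph V) : Type _ :=
  symbolicReesAlgebra (coverIdeal K G) ⧸
    (irrelevantIdeal K V).map
      (algebraMap (MvPolynomial V K) (symbolicReesAlgebra (coverIdeal K G)))

end GraphIdeals

end BasicCovers

namespace BasicCovers

/-! ### Basic covers, tight edges and edges of constant sum 1 -/

section Combinatorics

variable {V : Type*} {G : SimpleGraph V}

/-! A cover is basic exactly when each positive entry lies on a tight edge, one whose end values sum
to exactly `k`. From this, an edge `{i, j}` satisfies the square condition if and only if its sum is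
1 on every basic 1-cover (`add_eq_of_square`, `zeroOneAdj_square`), and then its sum is `k` on every
basic `k`-cover. Summing over a matching of such edges gives norm `kn/2`; conversely, if all basic
1-covers have `n/2` ones, each edge of a perfect matching must have sum exactly 1.

If norms are constant for each `k`, the basic `k`-covers are precisely the `k`-covers of least norm
`k r`, a property stable under addition, so `G` is a domain. In a domain graph every vertex has a
neighbour in `G^{0-1}` (`IsDomainGraph.exists_zeroOneAdj`). Components of `G^{0-1}` are then
complete bipartite, and two basic covers that differ by swapping the values on one component
(`exists_flip`) show that unmixedness makes its sides equal.

On the algebraic side, `J(G)^{(k)}` is spanned by the monomials of `k`-covers and `𝔪 R_s` by those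
of reducible covers, so products in `Ā(G)` record sums of basic covers. The associated primes of
`I(G)` are generated by the supports of basic 1-covers, so their heights count ones. -/

theorem exists_adj (hG : ∀ v : V, ¬ G.IsIsolated v) (v : V) : ∃ w, G.Adj v w := by
  simpa [SimpleGraph.IsIsolated] using hG v

/-- An entry on no tight edge can be lowered by one; conversely, subtracting anything at `i` breaks
a tight edge at `i`. Since there are edges and `k ≥ 1`, the inequalities already exclude the zero
vector. -/
theorem isBasicCover_iff [Nonempty V] (hG : ∀ v : V, ¬ G.IsIsolated v) {k : ℕ} (hk : 1 ≤ k)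
    {a : V → ℕ} :
    IsBasicCover G k a ↔ (∀ i j, G.Adj i j → k ≤ a i + a j) ∧
      ∀ i, 0 < a i → ∃ j, G.Adj i j ∧ a i + a j = k := by
  classical
  have ne : ∀ b : V → ℕ, (∀ i j, G.Adj i j → k ≤ b i + b j) → b ≠ 0 := by
    rintro b hb rfl
    obtain ⟨v⟩ := ‹Nonempty V›
    obtain ⟨w, hw⟩ := exists_adj hG v
    have := hb v w hw
    simp at this
    omega
  constructor
  · rintro ⟨⟨-, hc⟩, h⟩
    refine ⟨hc, fun i hi => ?_⟩
    by_contra! hno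
    refine h ⟨Function.update a i (a i - 1), Pi.single i 1, ⟨?_, ?_⟩, ⟨by simp, by simp⟩, ?_⟩
    · apply ne
      intro v w hvw
      have h1 := hc v w hvw
      by_cases hv : v = i
      · subst hv
        have := hno w hvw
        have hw : w ≠ v := hvw.ne'
        simp [hw]; omega
      · by_cases hw : w = i
        · subst hw
          have := hno v hvw.symm
          simp [hv]; omega
        · simpa [hv, hw] using h1
    · intro v w hvw
      have h1 := hc v w hvw
      by_cases hv : v = i
      · subst hv
        have := hno w hvw
        have hw : w ≠ v := hvw.ne'
        simp [hw]; omega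
      · by_cases hw : w = i
        · subst hw
          have := hno v hvw.symm
          simp [hv]; omega
        · simpa [hv, hw] using h1
    · ext v
      by_cases hv : v = i
      · subst hv; simp; omega
      · simp [hv]
  · rintro ⟨hc, h⟩
    refine ⟨⟨ne a hc, hc⟩, ?_⟩
    rintro ⟨b, c, ⟨-, hb⟩, ⟨hc0, -⟩, rfl⟩
    obtain ⟨i, hi⟩ := Function.ne_iff.mp hc0
    simp only [Pi.zero_apply, Pi.add_apply] at hi h
    obtain ⟨j, hij, e⟩ := h i (by omega)
    have := hb i j hij
    omega

theorem exists_isBasicCover_le [Fintype V] [Nonempty V] (hG : ∀ v : V, ¬ G.IsIsolated v) {k : ℕ}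
    (hk : 1 ≤ k) (a : V → ℕ) (ha : ∀ i j, G.Adj i j → k ≤ a i + a j) :
    ∃ b, IsBasicCover G k b ∧ b ≤ a := by
  classical
  obtain ⟨b, hba, hb⟩ := exists_minimal_le_of_wellFoundedLT
    (fun b : V → ℕ => ∀ i j, G.Adj i j → k ≤ b i + b j) a ha
  refine ⟨b, ⟨⟨?_, hb.1⟩, ?_⟩, hba⟩
  · rintro rfl
    obtain ⟨v⟩ := ‹Nonempty V›
    obtain ⟨w, hw⟩ := exists_adj hG v
    have := hb.1 v w hw
    simp at this
    omega
  · rintro ⟨c, d, hc, hd, rfl⟩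
    refine hd.1 ?_
    have h1 := hb.2 (y := c) hc.2 (by simp)
    ext v
    have := h1 v
    simp at this
    simp [this]

theorem IsBasicCover.le_one [Nonempty V] (hG : ∀ v : V, ¬ G.IsIsolated v) {a : V → ℕ}
    (ha : IsBasicCover G 1 a) (i : V) : a i ≤ 1 := by
  rcases Nat.eq_zero_or_pos (a i) with h | h
  · omega
  · obtain ⟨j, -, e⟩ := ((isBasicCover_iff hG le_rfl).1 ha).2 i h
    omega

theorem numOnes_eq_norm [Fintype V] [Nonempty V] (hG : ∀ v : V, ¬ G.IsIsolated v) {a : V → ℕ}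
    (ha : IsBasicCover G 1 a) : numOnes a = norm a := by
  unfold numOnes norm
  rw [Finset.card_filter]
  refine Finset.sum_congr rfl fun i _ => ?_
  have := ha.le_one hG i
  interval_cases a i <;> simp

/-- The complement of an independent set is a vertex cover, which shrinks to a basic one. This is
the source of the test covers used below. -/
theorem exists_isBasicCover_eq_zero [Fintype V] [Nonempty V] (hG : ∀ v : V, ¬ G.IsIsolated v)
    (I : Set V) (hI : ∀ v ∈ I, ∀ w ∈ I, ¬ G.Adj v w) :
    ∃ a, IsBasicCover G 1 a ∧ ∀ v ∈ I, a v = 0 := by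
  classical
  obtain ⟨b, hb, hle⟩ := exists_isBasicCover_le hG le_rfl (fun v => if v ∈ I then 0 else 1) (by
    intro i j hij
    by_cases hi : i ∈ I
    · have : j ∉ I := fun hj => hI i hi j hj hij
      simp [this]
    · simp [hi])
  exact ⟨b, hb, fun v hv => by simpa [hv] using hle v⟩

/-- Adjacency in `G^{0-1}`, on all vertices. -/
def ZeroOneAdj (G : SimpleGraph V) (i j : V) : Prop :=
  ∀ a : V → ℕ, IsBasicCover G 1 a → a i + a j = 1

theorem ZeroOneAdj.symm {i j : V} (h : ZeroOneAdj G i j) : ZeroOneAdj G j i := fun a ha => by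
  rw [add_comm]; exact h a ha

/-- Two nonadjacent vertices form an independent set, so some basic cover vanishes on both. Hence
`ZeroOneAdj` need not mention adjacency. -/
theorem adj_of_forall_one_le [Fintype V] [Nonempty V] (hG : ∀ v : V, ¬ G.IsIsolated v)
    {i j : V} (h : ∀ a : V → ℕ, IsBasicCover G 1 a → 1 ≤ a i + a j) : G.Adj i j := by
  by_contra hij
  obtain ⟨a, ha, h0⟩ := exists_isBasicCover_eq_zero hG {i, j} (by
    simp [hij, mt SimpleGraph.Adj.symm hij])
  have := h a ha
  simp [h0] at this

theorem ZeroOneAdj.adj [Fintype V] [Nonempty V] (hG : ∀ v : V, ¬ G.IsIsolated v)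
    {i j : V} (h : ZeroOneAdj G i j) : G.Adj i j :=
  adj_of_forall_one_le hG fun a ha => (h a ha).ge

/-- If the sum exceeded `k`, tight edges `{i, i'}` and `{j, j'}` would give `a i' + a j' < k` on an
edge supplied by the square condition. If one end is zero, the other would exceed `k` and lie on no
tight edge. -/
theorem add_eq_of_square [Nonempty V] (hG : ∀ v : V, ¬ G.IsIsolated v) {i j : V}
    (hij : G.Adj i j) (h : ∀ i' j', G.Adj i i' → G.Adj j j' → G.Adj i' j') {k : ℕ} (hk : 1 ≤ k)
    {a : V → ℕ} (ha : IsBasicCover G k a) : a i + a j = k := by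
  have h1 := ha.1.2 i j hij
  by_contra hne
  obtain ⟨hc, hm⟩ := (isBasicCover_iff hG hk).1 ha
  rcases Nat.eq_zero_or_pos (a i) with hi | hi
  · obtain ⟨j', -, e⟩ := hm j (by omega)
    omega
  · rcases Nat.eq_zero_or_pos (a j) with hj | hj
    · obtain ⟨i', -, e⟩ := hm i (by omega)
      omega
    · obtain ⟨i', hi', e⟩ := hm i hi
      obtain ⟨j', hj', e'⟩ := hm j hj
      have := hc i' j' (h i' j' hi' hj')
      omega

theorem exists_isBasicCover_add_eq_two [Fintype V] [Nonempty V] (hG : ∀ v : V, ¬ G.IsIsolated v)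
    {i j i' j' : V} (hi : G.Adj i i') (hj : G.Adj j j') (h : ¬ G.Adj i' j') :
    ∃ a, IsBasicCover G 1 a ∧ a i = 1 ∧ a j = 1 := by
  obtain ⟨a, ha, h0⟩ := exists_isBasicCover_eq_zero hG {i', j'} (by
    simp [h, mt SimpleGraph.Adj.symm h])
  have h1 := ha.1.2 _ _ hi
  have h2 := ha.1.2 _ _ hj
  have h3 := ha.le_one hG i
  have h4 := ha.le_one hG j
  have h5 := h0 i' (by simp)
  have h6 := h0 j' (by simp)
  exact ⟨a, ha, by omega, by omega⟩

theorem zeroOneAdj_square [Fintype V] [Nonempty V] (hG : ∀ v : V, ¬ G.IsIsolated v)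
    {i j i' j' : V} (h : ZeroOneAdj G i j) (hi : G.Adj i i') (hj : G.Adj j j') :
    G.Adj i' j' := by
  by_contra hn
  obtain ⟨a, ha, h1, h2⟩ := exists_isBasicCover_add_eq_two hG hi hj hn
  have := h a ha
  omega

theorem IsBasicCover.smul [Nonempty V] (hG : ∀ v : V, ¬ G.IsIsolated v) {a : V → ℕ}
    (ha : IsBasicCover G 1 a) {k : ℕ} (hk : 1 ≤ k) : IsBasicCover G k (fun v => k * a v) := by
  rw [isBasicCover_iff hG hk]
  obtain ⟨hc, hm⟩ := (isBasicCover_iff hG le_rfl).1 ha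
  refine ⟨fun i j hij => ?_, fun i hi => ?_⟩
  · rw [← mul_add]; exact Nat.le_mul_of_pos_right k (hc i j hij)
  · obtain ⟨j, hij, e⟩ := hm i (Nat.pos_of_mul_pos_left hi)
    exact ⟨j, hij, by rw [← mul_add, e, mul_one]⟩

/-- If all basic `k`-covers have the same norm, for each `k`, then these norms are the multiples
of one number, and the norm detects the basic covers among all covers. -/
theorem exists_norm_eq_mul [Fintype V] [Nonempty V] (hG : ∀ v : V, ¬ G.IsIsolated v)
    (h : ∀ k : ℕ, 1 ≤ k → ∀ a b : V → ℕ, IsBasicCover G k a → IsBasicCover G k b →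
      norm a = norm b) :
    ∃ r : ℕ, ∀ k, 1 ≤ k → ∀ a : V → ℕ, (∀ i j, G.Adj i j → k ≤ a i + a j) →
      k * r ≤ norm a ∧ (IsBasicCover G k a ↔ norm a = k * r) := by
  -- Any basic 1-cover serves: its multiple `k * c` is a basic `k`-cover, which fixes the common
  -- norm as `k * norm c`.
  obtain ⟨c, hc, -⟩ := exists_isBasicCover_eq_zero hG ∅ (by simp)
  refine ⟨norm c, fun k hk a ha => ?_⟩
  have key : ∀ b, IsBasicCover G k b → norm b = k * norm c := fun b hb => by
    rw [h k hk b _ hb (hc.smul hG hk), norm, norm, Finset.mul_sum]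
  obtain ⟨b, hb, hle⟩ := exists_isBasicCover_le hG hk a ha
  have hn : norm b ≤ norm a := Finset.sum_le_sum fun i _ => hle i
  refine ⟨key b hb ▸ hn, key a, fun e => ?_⟩
  have : b = a := by
    ext i
    exact (Finset.sum_eq_sum_iff_of_le (fun i _ => hle i)).1 ((key b hb).trans e.symm) i
      (Finset.mem_univ i)
  exact this ▸ hb

theorem norm_add [Fintype V] (a b : V → ℕ) : norm (a + b) = norm a + norm b := by
  simp [norm, Finset.sum_add_distrib]

theorem norm_sum [Fintype V] {ι : Type*} (s : Finset ι) (a : ι → V → ℕ) :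
    norm (∑ p ∈ s, a p) = ∑ p ∈ s, norm (a p) := by
  simp only [norm, Finset.sum_apply]
  exact Finset.sum_comm

theorem isUnmixedGraph_and_isDomainGraph [Fintype V] [Nonempty V]
    (hG : ∀ v : V, ¬ G.IsIsolated v)
    (h : ∀ k : ℕ, 1 ≤ k → ∀ a b : V → ℕ, IsBasicCover G k a → IsBasicCover G k b →
      norm a = norm b) : IsUnmixedGraph G ∧ IsDomainGraph G := by
  refine ⟨fun a b ha hb => ?_, fun s t hst a b ha hb => ?_⟩
  · rw [numOnes_eq_norm hG ha, numOnes_eq_norm hG hb, h 1 le_rfl a b ha hb]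
  · obtain ⟨r, hr⟩ := exists_norm_eq_mul hG h
    refine ((hr (s + 2 * t) (by omega) _ ?_).2).2 ?_
    · intro i j hij
      have h1 : s ≤ ∑ p, (a p i + a p j) := by
        simpa using Finset.card_nsmul_le_sum Finset.univ _ 1 fun p _ => (ha p).1.2 i j hij
      have h2 : 2 * t ≤ ∑ q, (b q i + b q j) := by
        simpa [mul_comm] using
          Finset.card_nsmul_le_sum Finset.univ _ 2 fun q _ => (hb q).1.2 i j hij
      simp only [Finset.sum_add_distrib] at h1 h2
      simp only [Pi.add_apply, Finset.sum_apply]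
      omega
    · rw [norm_add, norm_sum, norm_sum,
        Finset.sum_congr rfl fun p _ => ((hr 1 le_rfl _ (ha p).1.2).2).1 (ha p),
        Finset.sum_congr rfl fun q _ => ((hr 2 (by omega) _ (hb q).1.2).2).1 (hb q)]
      simp
      ring

/-- Otherwise each edge `{i, j}` has sum 2 on some basic 1-cover. Adding one such cover per vertex
leaves no tight edge at `i`, so the sum is not basic. -/
theorem IsDomainGraph.exists_zeroOneAdj [Fintype V] [Nonempty V]
    (hG : ∀ v : V, ¬ G.IsIsolated v) (h : IsDomainGraph G) (i : V) : ∃ j, ZeroOneAdj G i j := by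
  classical
  by_contra! hno
  have key : ∀ j, ∃ a : V → ℕ, IsBasicCover G 1 a ∧ (G.Adj i j → a i = 1 ∧ a j = 1) := by
    intro j
    have h1 := hno j
    simp only [ZeroOneAdj, not_forall] at h1
    obtain ⟨a, ha, hne⟩ := h1
    refine ⟨a, ha, fun hij => ?_⟩
    have := ha.1.2 i j hij
    have := ha.le_one hG i
    have := ha.le_one hG j
    omega
  choose a ha hij using key
  let e := Fintype.equivFin V
  -- One summand is taken for every vertex, non-neighbours of `i` included, where any basic 1-cover
  -- will do; no basic 2-covers are needed.
  have hd := h (Fintype.card V) 0 (by simp [Fintype.card_pos]) (fun p => a (e.symm p)) (fun _ => 0)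
    (fun p => ha _) (fun q => q.elim0)
  have hs : ∑ p, a (e.symm p) = ∑ j, a j := Equiv.sum_comp e.symm a
  simp only [mul_zero, add_zero, Finset.univ_eq_empty, Finset.sum_empty, hs] at hd
  have hcard : 1 ≤ Fintype.card V := Fintype.card_pos
  obtain ⟨-, hm⟩ := (isBasicCover_iff hG hcard).1 hd
  simp only [Finset.sum_apply] at hm
  obtain ⟨w, hw⟩ := exists_adj hG i
  obtain ⟨j, hj, he⟩ := hm i (Finset.sum_pos' (fun _ _ => Nat.zero_le _)
    ⟨w, Finset.mem_univ _, by rw [(hij w hw).1]; exact one_pos⟩)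
  rw [← Finset.sum_add_distrib] at he
  have : ∑ j' : V, 1 < ∑ j', (a j' i + a j' j) :=
    Finset.sum_lt_sum (fun j' _ => (ha j').1.2 i j hj)
      ⟨j, Finset.mem_univ _, by rw [(hij j hj).1, (hij j hj).2]; norm_num⟩
  simp at this
  omega

end Combinatorics

/-! ### Perfect matchings as involutions, and counting along them -/

section Matchings

theorem exists_involutive_of_isPerfectMatching {W : Type*} {H : SimpleGraph W} {M : H.Subgraph}
    (hM : M.IsPerfectMatching) :
    ∃ f : W → W, Function.Involutive f ∧ ∀ w v, M.Adj w v ↔ f w = v := by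
  rw [SimpleGraph.Subgraph.isPerfectMatching_iff] at hM
  choose f hf hu using hM
  refine ⟨f, fun w => ?_, fun w v => ⟨fun h => (hu w v h).symm, fun h => h ▸ hf w⟩⟩
  exact (hu _ _ (hf w).symm).symm

theorem exists_isPerfectMatching_of_involutive {W : Type*} {H : SimpleGraph W} {f : W → W}
    (hf : Function.Involutive f) (hH : ∀ w, H.Adj w (f w)) :
    ∃ M : H.Subgraph, M.IsPerfectMatching ∧ ∀ w v, M.Adj w v ↔ f w = v :=
  ⟨{ verts := Set.univ
     Adj := fun w v => f w = v
     adj_sub := by rintro w v rfl; exact hH w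
     edge_vert := fun _ => Set.mem_univ _
     symm := ⟨by rintro w v rfl; exact hf w⟩ },
    SimpleGraph.Subgraph.isPerfectMatching_iff.2 fun w => ⟨f w, rfl, fun v h => Eq.symm (show f w = v from h)⟩,
    fun _ _ => Iff.rfl⟩

variable {V : Type*} {G : SimpleGraph V}

theorem mem_support_of_forall_not_isIsolated (hG : ∀ v : V, ¬ G.IsIsolated v) (v : V) :
    v ∈ G.support :=
  (SimpleGraph.mem_support_iff_not_isIsolated _).2 (hG v)

theorem msc_iff [Fintype V] [Nonempty V] (hG : ∀ v : V, ¬ G.IsIsolated v) :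
    MSC G ↔ ∃ f : V → V, Function.Involutive f ∧ ∀ i, ZeroOneAdj G i (f i) := by
  have hs := mem_support_of_forall_not_isIsolated hG
  constructor
  · rintro ⟨-, M, hM, hsq⟩
    obtain ⟨f, hf, hMf⟩ := exists_involutive_of_isPerfectMatching hM
    refine ⟨fun v => f ⟨v, hs v⟩, fun v => by simp [hf _], fun v a ha => ?_⟩
    have hadj := (hMf ⟨v, hs v⟩ _).2 rfl
    exact add_eq_of_square hG (M.adj_sub hadj) (hsq _ _ hadj) le_rfl ha
  · rintro ⟨f, hf, hz⟩
    obtain ⟨v⟩ := ‹Nonempty V›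
    obtain ⟨M, hM, hMf⟩ := exists_isPerfectMatching_of_involutive (H := red G)
      (f := fun w : G.support => ⟨f w, hs _⟩) (fun w => Subtype.ext (hf w))
      (fun w => (hz w).adj hG)
    refine ⟨⟨v, hs v⟩, M, hM, fun i j hij i' j' hi hj => ?_⟩
    rw [hMf] at hij
    subst hij
    exact zeroOneAdj_square hG (hz i) hi hj

theorem zeroOneGraph_adj [Fintype V] [Nonempty V] (hG : ∀ v : V, ¬ G.IsIsolated v)
    {i j : G.support} : (zeroOneGraph G).Adj i j ↔ ZeroOneAdj G i j :=
  ⟨fun h => h.2, fun h => ⟨h.adj hG, h⟩⟩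

theorem exists_isPerfectMatching_zeroOneGraph_iff [Fintype V] [Nonempty V]
    (hG : ∀ v : V, ¬ G.IsIsolated v) :
    (∃ M : (zeroOneGraph G).Subgraph, M.IsPerfectMatching) ↔
      ∃ f : V → V, Function.Involutive f ∧ ∀ i, ZeroOneAdj G i (f i) := by
  have hs := mem_support_of_forall_not_isIsolated hG
  constructor
  · rintro ⟨M, hM⟩
    obtain ⟨f, hf, hMf⟩ := exists_involutive_of_isPerfectMatching hM
    exact ⟨fun v => f ⟨v, hs v⟩, fun v => by simp [hf _],
      fun v => (M.adj_sub ((hMf ⟨v, hs v⟩ _).2 rfl)).2⟩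
  · rintro ⟨f, hf, hz⟩
    obtain ⟨M, hM, -⟩ := exists_isPerfectMatching_of_involutive (H := zeroOneGraph G)
      (f := fun w : G.support => ⟨f w, hs _⟩) (fun w => Subtype.ext (hf w))
      (fun w => (zeroOneGraph_adj hG).2 (hz w))
    exact ⟨M, hM⟩

theorem two_mul_norm_of_involutive [Fintype V] {f : V → V} (hf : Function.Involutive f) {k : ℕ}
    {a : V → ℕ} (h : ∀ i, a i + a (f i) = k) : 2 * norm a = k * Fintype.card V := by
  have h1 : ∑ i, a (f i) = ∑ i, a i := Equiv.sum_comp hf.toPerm a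
  have h2 : ∑ i, (a i + a (f i)) = ∑ _i : V, k := Finset.sum_congr rfl fun i _ => h i
  rw [Finset.sum_add_distrib, h1] at h2
  simp only [Finset.sum_const, Finset.card_univ, smul_eq_mul] at h2
  rw [norm, two_mul, h2, mul_comm]

theorem MSC.norm_eq [Fintype V] [Nonempty V] (hG : ∀ v : V, ¬ G.IsIsolated v) (h : MSC G)
    {k : ℕ} (hk : 1 ≤ k) {a : V → ℕ} (ha : IsBasicCover G k a) :
    (norm a : ℚ) = (k : ℚ) * (Fintype.card V : ℚ) / 2 := by
  obtain ⟨f, hf, hz⟩ := (msc_iff hG).1 h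
  have := two_mul_norm_of_involutive hf fun i =>
    add_eq_of_square hG ((hz i).adj hG) (fun _ _ => zeroOneAdj_square hG (hz i)) hk ha
  rw [eq_div_iff two_ne_zero]
  exact_mod_cast (mul_comm _ _).trans this

theorem MSC.exists_isPerfectMatching [Fintype V] [Nonempty V] (hG : ∀ v : V, ¬ G.IsIsolated v)
    (h : MSC G) : ∃ M : G.Subgraph, M.IsPerfectMatching := by
  obtain ⟨f, hf, hz⟩ := (msc_iff hG).1 h
  obtain ⟨M, hM, -⟩ := exists_isPerfectMatching_of_involutive hf fun i => (hz i).adj hG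
  exact ⟨M, hM⟩

/-- Each matching edge contributes at least 1 to the norm, so `n/2` is the least possible value, and
attaining it forces every matching edge to sum to exactly 1. -/
theorem exists_isPerfectMatching_zeroOneGraph [Fintype V] [Nonempty V]
    (hG : ∀ v : V, ¬ G.IsIsolated v) (hM : ∃ M : G.Subgraph, M.IsPerfectMatching)
    (h : ∀ a : V → ℕ, IsBasicCover G 1 a → (numOnes a : ℚ) = (Fintype.card V : ℚ) / 2) :
    ∃ M : (zeroOneGraph G).Subgraph, M.IsPerfectMatching := by
  obtain ⟨M, hM⟩ := hM
  obtain ⟨f, hf, hMf⟩ := exists_involutive_of_isPerfectMatching hM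
  refine (exists_isPerfectMatching_zeroOneGraph_iff hG).2 ⟨f, hf, fun i a ha => ?_⟩
  have h1 := h a ha
  rw [numOnes_eq_norm hG ha, eq_div_iff two_ne_zero] at h1
  have h2 : norm a * 2 = Fintype.card V := by exact_mod_cast h1
  have hle : ∀ j, 1 ≤ a j + a (f j) := fun j => ha.1.2 _ _ (M.adj_sub ((hMf j _).2 rfl))
  have h3 : ∑ i, a (f i) = ∑ i, a i := Equiv.sum_comp hf.toPerm a
  have h4 : ∑ _j : V, 1 = ∑ j, (a j + a (f j)) := by
    rw [Finset.sum_add_distrib, h3]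
    simp only [Finset.sum_const, Finset.card_univ, smul_eq_mul, mul_one]
    rw [← h2, norm, mul_two]
  exact ((Finset.sum_eq_sum_iff_of_le (fun j _ => hle j)).1 h4 i (Finset.mem_univ i)).symm

end Matchings

/-! ### Components of the graph `G^{0-1}` -/

section Components

variable {V : Type*} [Fintype V] [Nonempty V] {G : SimpleGraph V}

/-- If every vertex has a neighbour in `G^{0-1}`, then there are two basic `1`-covers that differ
exactly on the component of `G^{0-1}` that contains the edge `{p, q}`. -/
theorem exists_flip (hG : ∀ v : V, ¬ G.IsIsolated v) (hz : ∀ i, ∃ j, ZeroOneAdj G i j) {p q : V}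
    (hpq : ZeroOneAdj G p q) : ∃ a b : V → ℕ, IsBasicCover G 1 a ∧ IsBasicCover G 1 b ∧
      a p = 0 ∧ b p = 1 ∧ ∀ v, ¬ ZeroOneAdj G p v → ¬ ZeroOneAdj G q v → a v = b v := by
  classical
  have Padd : ∀ v w, ZeroOneAdj G q v → ZeroOneAdj G p w → ZeroOneAdj G v w := by
    intro v w hv hw a ha
    have := hv a ha
    have := hw a ha
    have := hpq a ha
    omega
  -- Every basic cover is constant on each side of the component, with values `b p` and `b q`. The
  -- set consists of `p` and the vertices outside the component that are dominated by `p` or by `q`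
  -- in all basic covers.
  set I : Set V := {w | w = p ∨ (¬ ZeroOneAdj G p w ∧ ¬ ZeroOneAdj G q w) ∧
    ((∀ b, IsBasicCover G 1 b → b w ≤ b p) ∨ ∀ b, IsBasicCover G 1 b → b w ≤ b q)} with hI
  have nadj : ∀ u v w, (∀ b, IsBasicCover G 1 b → b v ≤ b u) →
      (∀ b, IsBasicCover G 1 b → b w ≤ b u) → ¬ G.Adj v w := by
    intro u v w hv hw hvw
    obtain ⟨c, hc, h0⟩ := exists_isBasicCover_eq_zero hG {u} (by simp)
    have := hv c hc
    have := hw c hc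
    have := h0 u rfl
    have := hc.1.2 v w hvw
    omega
  -- If `v` is dominated by `p`, `w` by `q` and they are adjacent, then `1 ≤ b v + b w ≤ b p + b q =
  -- 1` forces `b w = b q`, which puts `w` in the component.
  have cross : ∀ v w, (∀ b, IsBasicCover G 1 b → b v ≤ b p) → ¬ ZeroOneAdj G p w →
      (∀ b, IsBasicCover G 1 b → b w ≤ b q) → ¬ G.Adj v w := by
    intro v w hv hw' hw hvw
    refine hw' fun b hb => ?_
    have := hv b hb
    have := hw b hb
    have := hpq b hb
    have := hb.1.2 v w hvw
    omega
  obtain ⟨a, ha, ha0⟩ := exists_isBasicCover_eq_zero hG I (by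
    rintro v (rfl | ⟨⟨hv1, hv2⟩, hv⟩) w (rfl | ⟨⟨hw1, hw2⟩, hw⟩)
    · exact G.loopless.irrefl _
    · rcases hw with hw | hw
      · exact nadj v v w (fun _ _ => le_rfl) hw
      · exact cross v w (fun _ _ => le_rfl) hw1 hw
    · rcases hv with hv | hv
      · exact nadj w v w hv (fun _ _ => le_rfl)
      · exact fun h => cross w v (fun _ _ => le_rfl) hv1 hv h.symm
    · rcases hv with hv | hv <;> rcases hw with hw | hw
      · exact nadj p v w hv hw
      · exact cross v w hv hw1 hw
      · exact fun h => cross w v hw hv1 hv h.symm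
      · exact nadj q v w hv hw)
  have hp0 : a p = 0 := ha0 p (Or.inl rfl)
  have hq1 : a q = 1 := by have := hpq a ha; omega
  have hP : ∀ v, ZeroOneAdj G q v → a v = 0 := fun v hv => by have := hv a ha; omega
  have hQ : ∀ v, ZeroOneAdj G p v → a v = 1 := fun v hv => by have := hv a ha; omega
  have htr : ∀ u v w, ZeroOneAdj G u v → ZeroOneAdj G v w → ∀ t, ZeroOneAdj G t w →
      ZeroOneAdj G t u := by
    intro u v w h1 h2 t h3 b hb
    have := h1 b hb
    have := h2 b hb
    have := h3 b hb
    omega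
  -- The values 0 and 1 are exchanged on the component only.
  set b : V → ℕ := fun v => if ZeroOneAdj G p v ∨ ZeroOneAdj G q v then 1 - a v else a v with hb
  have hbP : ∀ v, ZeroOneAdj G q v → b v = 1 := fun v hv => by simp [hb, hv, hP v hv]
  have hbQ : ∀ v, ZeroOneAdj G p v → b v = 0 := fun v hv => by simp [hb, hv, hQ v hv]
  have hbN : ∀ v, ¬ ZeroOneAdj G p v → ¬ ZeroOneAdj G q v → b v = a v :=
    fun v h1 h2 => by simp [hb, h1, h2]
  -- The side of `q` drops to 0, so its outside neighbours must already have value 1. A 0-1 partner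
  -- `w'` of such a neighbour `w` satisfies `c w' = 1 - c w ≤ c v = c q`, hence lies in `I`, where
  -- `a` vanishes.
  have out : ∀ v w, G.Adj v w → ZeroOneAdj G p v → ¬ ZeroOneAdj G p w → ¬ ZeroOneAdj G q w →
      a w = 1 := by
    intro v w hvw hv h1 h2
    obtain ⟨w', hw'⟩ := hz w
    have : w' ∈ I := by
      refine Or.inr ⟨⟨fun h => ?_, fun h => ?_⟩, Or.inr fun c hc => ?_⟩
      · refine h2 fun c hc => ?_
        have := h c hc
        have := hw' c hc
        have := hpq c hc
        omega
      · refine h1 fun c hc => ?_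
        have := h c hc
        have := hw' c hc
        have := hpq c hc
        omega
      · have := hv c hc
        have := hw' c hc
        have := hpq c hc
        have := hc.1.2 v w hvw
        omega
    have h0 := ha0 w' this
    have := hw' a ha
    omega
  refine ⟨a, b, ha, ?_, hp0, hbP p hpq.symm, fun v h1 h2 => (hbN v h1 h2).symm⟩
  rw [isBasicCover_iff hG le_rfl]
  constructor
  · intro v w hvw
    by_cases hvP : ZeroOneAdj G q v
    · rw [hbP v hvP]; omega
    by_cases hwP : ZeroOneAdj G q w
    · rw [hbP w hwP]; omega
    by_cases hvQ : ZeroOneAdj G p v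
    · by_cases hwQ : ZeroOneAdj G p w
      · obtain ⟨c, hc, h0⟩ := exists_isBasicCover_eq_zero hG {q} (by simp)
        have h0 := h0 q rfl
        obtain ⟨c, hc, h0⟩ := exists_isBasicCover_eq_zero hG {v} (by simp)
        have h0 := h0 v rfl
        have := hvQ c hc
        have := hwQ c hc
        have := hc.1.2 v w hvw
        omega
      · rw [hbN w hwQ hwP, out v w hvw hvQ hwQ hwP]; omega
    · by_cases hwQ : ZeroOneAdj G p w
      · rw [hbN v hvQ hvP, out w v hvw.symm hwQ hvQ hvP]; omega
      · rw [hbN v hvQ hvP, hbN w hwQ hwP]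
        exact ha.1.2 v w hvw
  · intro v _
    by_cases hvP : ZeroOneAdj G q v
    · exact ⟨q, hvP.symm.adj hG, by rw [hbP v hvP, hbQ q hpq]⟩
    by_cases hvQ : ZeroOneAdj G p v
    · exact ⟨p, hvQ.symm.adj hG, by rw [hbQ v hvQ, hbP p hpq.symm]⟩
    obtain ⟨w, hw⟩ := hz v
    refine ⟨w, hw.adj hG, ?_⟩
    rw [hbN v hvQ hvP, hbN w, hw a ha]
    · refine fun h => hvP fun c hc => ?_
      have := h c hc
      have := hw c hc
      have := hpq c hc
      omega
    · refine fun h => hvQ fun c hc => ?_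
      have := h c hc
      have := hw c hc
      have := hpq c hc
      omega

/-- The two covers of `exists_flip` have their ones on opposite sides of the component and agree
elsewhere; unmixedness equates the counts. -/
theorem card_zeroOneAdj_eq (hG : ∀ v : V, ¬ G.IsIsolated v) (hu : IsUnmixedGraph G)
    (hz : ∀ i, ∃ j, ZeroOneAdj G i j) {p q : V} (hpq : ZeroOneAdj G p q) :
    Nat.card {v // ZeroOneAdj G p v} = Nat.card {v // ZeroOneAdj G q v} := by
  classical
  obtain ⟨a, b, ha, hb, hap, hbp, hab⟩ := exists_flip hG hz hpq
  have hn := hu a b ha hb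
  rw [numOnes_eq_norm hG ha, numOnes_eq_norm hG hb] at hn
  have h1 : ∀ v, a v + (if ZeroOneAdj G q v then 1 else 0) =
      b v + (if ZeroOneAdj G p v then 1 else 0) := by
    intro v
    by_cases hv : ZeroOneAdj G p v
    · have hv' : ¬ ZeroOneAdj G q v := fun h => by
        have := h a ha
        have := hv a ha
        have := hpq a ha
        omega
      have := hv a ha
      have := hv b hb
      simp [hv, hv']
      omega
    · by_cases hv' : ZeroOneAdj G q v
      · have := hv' a ha
        have := hpq a ha
        have := hv' b hb
        have := hpq b hb
        simp [hv, hv']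
        omega
      · simp [hv, hv', hab v hv hv']
  have h2 := Finset.sum_congr (rfl : (Finset.univ : Finset V) = Finset.univ) fun v _ => h1 v
  rw [Finset.sum_add_distrib, Finset.sum_add_distrib, ← Finset.card_filter,
    ← Finset.card_filter] at h2
  simp only [norm] at hn
  rw [Nat.card_eq_fintype_card, Nat.card_eq_fintype_card, Fintype.card_subtype,
    Fintype.card_subtype]
  omega

theorem exists_iso_completeBipartiteGraph (hG : ∀ v : V, ¬ G.IsIsolated v)
    (hu : IsUnmixedGraph G) (hd : IsDomainGraph G) (C : (zeroOneGraph G).ConnectedComponent) :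
    ∃ a : ℕ, 1 ≤ a ∧
      Nonempty (C.toSimpleGraph ≃g completeBipartiteGraph (Fin a) (Fin a)) := by
  classical
  have hs := mem_support_of_forall_not_isIsolated hG
  have hz := hd.exists_zeroOneAdj hG
  induction C using SimpleGraph.ConnectedComponent.ind with | _ p
  obtain ⟨q, hpq⟩ := hz p
  have hne : ∀ v, ZeroOneAdj G p v → ¬ ZeroOneAdj G q v := fun v h1 h2 => by
    obtain ⟨c, hc, -⟩ := exists_isBasicCover_eq_zero hG ∅ (by simp)
    have := h1 c hc
    have := h2 c hc
    have := hpq c hc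
    omega
  -- A path in `G^{0-1}` alternates between the two values `c p` and `c q`, simultaneously for all
  -- basic covers `c`, so two steps never leave the neighbourhoods of `p` and `q`.
  have hreach : ∀ v, (zeroOneGraph G).Reachable v p ↔ ZeroOneAdj G p v ∨ ZeroOneAdj G q v := by
    intro v
    constructor
    · rintro ⟨w⟩
      induction w with
      | nil => exact Or.inr hpq.symm
      | @cons u v w h _ ih =>
        have h := h.2
        rcases ih hpq hne with h' | h'
        · right
          intro c hc
          have := h c hc
          have := h' c hc
          have := hpq c hc
          omega
        · left
          intro c hc
          have := h c hc
          have := h' c hc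
          have := hpq c hc
          omega
    · rintro (h | h)
      · exact ((zeroOneGraph_adj hG).2 h.symm).reachable
      · exact (((zeroOneGraph_adj hG (j := ⟨q, hs q⟩)).2 h.symm).reachable).trans
          ((zeroOneGraph_adj hG).2 hpq.symm).reachable
  set C := (zeroOneGraph G).connectedComponentMk p
  have hC : ∀ v : C, ZeroOneAdj G p v.1 ∨ ZeroOneAdj G q v.1 := fun v =>
    (hreach v.1).1 (SimpleGraph.ConnectedComponent.exact v.2)
  have hC' : ∀ v : V, ZeroOneAdj G p v ∨ ZeroOneAdj G q v → (⟨v, hs v⟩ : G.support) ∈ C.supp :=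
    fun v h => SimpleGraph.ConnectedComponent.sound ((hreach ⟨v, hs v⟩).2 h)
  have e1 : {v : C // ZeroOneAdj G p v.1} ≃ {v // ZeroOneAdj G p v} :=
    { toFun := fun v => ⟨v.1.1, v.2⟩
      invFun := fun v => ⟨⟨⟨v.1, hs _⟩, hC' _ (Or.inl v.2)⟩, v.2⟩
      left_inv := fun _ => rfl
      right_inv := fun _ => rfl }
  have e2 : {v : C // ¬ ZeroOneAdj G p v.1} ≃ {v // ZeroOneAdj G q v} :=
    { toFun := fun v => ⟨v.1.1, (hC v.1).resolve_left v.2⟩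
      invFun := fun v => ⟨⟨⟨v.1, hs _⟩, hC' _ (Or.inr v.2)⟩, fun h => hne _ h v.2⟩
      left_inv := fun _ => rfl
      right_inv := fun _ => rfl }
  have hcard := card_zeroOneAdj_eq hG hu hz hpq
  refine ⟨Nat.card {v // ZeroOneAdj G p v}, ?_, ⟨?_⟩⟩
  · have : Nonempty {v // ZeroOneAdj G p v} := ⟨⟨q, hpq⟩⟩
    exact Nat.card_pos
  let f1 := e1.trans (Finite.equivFin _)
  let f2 := e2.trans (Finite.equivFinOfCardEq hcard.symm)
  let F := (Equiv.sumCompl fun v : C => ZeroOneAdj G p v.1).symm.trans (Equiv.sumCongr f1 f2)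
  have hF1 : ∀ v : C, ZeroOneAdj G p v.1 → (F v).isLeft = true ∧ (F v).isRight = false := by
    intro v hv
    have : F v = Sum.inl (f1 ⟨v, hv⟩) :=
      F.eq_symm_apply.1 (by simp [F])
    simp [this]
  have hF2 : ∀ v : C, ¬ ZeroOneAdj G p v.1 → (F v).isLeft = false ∧ (F v).isRight = true := by
    intro v hv
    have : F v = Sum.inr (f2 ⟨v, hv⟩) :=
      F.eq_symm_apply.1 (by simp [F])
    simp [this]
  refine ⟨F, fun {v w} => ?_⟩
  have hadj : C.toSimpleGraph.Adj v w ↔ ZeroOneAdj G v.1 w.1 := zeroOneGraph_adj hG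
  rw [hadj, completeBipartiteGraph_adj]
  obtain ⟨c, hc, -⟩ := exists_isBasicCover_eq_zero hG ∅ (by simp)
  have hc1 := hpq c hc
  by_cases hv : ZeroOneAdj G p v.1 <;> by_cases hw : ZeroOneAdj G p w.1
  · simp only [hF1 v hv, hF1 w hw]
    simp only [Bool.false_eq_true, and_false, false_and, or_self, false_iff]
    intro h
    have := h c hc
    have := hv c hc
    have := hw c hc
    omega
  · have hw' := (hC w).resolve_left hw
    simp only [hF1 v hv, hF2 w hw]
    simp only [and_self, true_or, true_iff]
    intro c hc
    have := hv c hc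
    have := hw' c hc
    have := hpq c hc
    omega
  · have hv' := (hC v).resolve_left hv
    simp only [hF2 v hv, hF1 w hw]
    simp only [and_self, or_true, true_iff]
    intro c hc
    have := hw c hc
    have := hv' c hc
    have := hpq c hc
    omega
  · have hv' := (hC v).resolve_left hv
    have hw' := (hC w).resolve_left hw
    simp only [hF2 v hv, hF2 w hw]
    simp only [Bool.false_eq_true, and_false, false_and, or_self, false_iff]
    intro h
    have := h c hc
    have := hv' c hc
    have := hw' c hc
    omega

/-- Swapping the two copies of `Fin a` in each component is an involution along edges. -/
theorem exists_isPerfectMatching_of_iso_completeBipartiteGraph {W : Type*} {H : SimpleGraph W}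
    (h : ∀ C : H.ConnectedComponent, ∃ a : ℕ, 1 ≤ a ∧
      Nonempty (C.toSimpleGraph ≃g completeBipartiteGraph (Fin a) (Fin a))) :
    ∃ M : H.Subgraph, M.IsPerfectMatching := by
  choose a _ φ using h
  let e := fun C => (φ C).some
  let g := fun (C : H.ConnectedComponent) (v : C) => (e C).symm (Sum.swap (e C v))
  let f : W → W := fun v => (g (H.connectedComponentMk v) ⟨v, rfl⟩).1
  have hfg : ∀ (C : H.ConnectedComponent) (v : C), f v.1 = (g C v).1 := by
    rintro C ⟨v, rfl⟩
    rfl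
  obtain ⟨M, hM, -⟩ := exists_isPerfectMatching_of_involutive (H := H) (f := f) (fun v => by
    rw [hfg _ (g (H.connectedComponentMk v) ⟨v, rfl⟩)]
    simp [g]) (fun v => by
    have : (H.connectedComponentMk v).toSimpleGraph.Adj ⟨v, rfl⟩
        (g (H.connectedComponentMk v) ⟨v, rfl⟩) := by
      rw [← (e _).map_adj_iff]
      simp only [g, RelIso.apply_symm_apply, completeBipartiteGraph_adj, Sum.isLeft_swap,
        Sum.isRight_swap]
      cases (e (H.connectedComponentMk v) ⟨v, rfl⟩) <;> simp
    exact this)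
  exact ⟨M, hM⟩

end Components

/-! ### Primes generated by variables -/

section VariableIdeals

variable {V : Type*} {K : Type*} [Field K]

/-- The homomorphism that multiplies the variables in `s` by a new variable. -/
noncomputable def scaleHom (K : Type*) [Field K] (s : Set V) :
    MvPolynomial V K →ₐ[K] Polynomial (MvPolynomial V K) :=
  open Classical in
  MvPolynomial.aeval fun v =>
    (if v ∈ s then Polynomial.X else 1) * Polynomial.C (MvPolynomial.X v)

theorem scaleHom_monomial [Fintype V] (s : Finset V) (u : V →₀ ℕ) (c : K) :
    scaleHom K (s : Set V) (MvPolynomial.monomial u c) =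
      Polynomial.monomial (∑ i ∈ s, u i) (MvPolynomial.monomial u c) := by
  classical
  rw [scaleHom, MvPolynomial.aeval_monomial, Finsupp.prod_fintype _ _ (by simp)]
  simp only [mul_pow, Finset.prod_mul_distrib, Finset.mem_coe, ite_pow, one_pow]
  rw [Finset.prod_ite_mem, Finset.univ_inter, Finset.prod_pow_eq_pow_sum,
    ← Polynomial.C_mul_X_pow_eq_monomial, MvPolynomial.monomial_eq,
    Finsupp.prod_fintype _ _ (by simp), Polynomial.C_mul, map_prod]
  simp only [Polynomial.C_pow, Polynomial.algebraMap_eq, IsScalarTower.algebraMap_apply K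
    (MvPolynomial V K) (Polynomial (MvPolynomial V K)), MvPolynomial.algebraMap_eq]
  ring

theorem coeff_scaleHom [Fintype V] (s : Finset V) (f : MvPolynomial V K) (u : V →₀ ℕ) (d : ℕ) :
    MvPolynomial.coeff u ((scaleHom K (s : Set V) f).coeff d) =
      if ∑ i ∈ s, u i = d then MvPolynomial.coeff u f else 0 := by
  classical
  induction f using MvPolynomial.induction_on' with
  | monomial w c =>
    rw [scaleHom_monomial, Polynomial.coeff_monomial, MvPolynomial.coeff_monomial]
    by_cases h : w = u
    · subst h
      rw [if_pos rfl]
      split_ifs <;> simp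
    · split_ifs <;> simp [MvPolynomial.coeff_monomial, h]
  | add p q hp hq =>
    rw [map_add, Polynomial.coeff_add, MvPolynomial.coeff_add, hp, hq, MvPolynomial.coeff_add]
    split_ifs <;> simp

/-- The exponent of the new variable records the degree of a monomial in the variables of `s`, so
divisibility by its powers measures the order of vanishing along the prime generated by `s`. -/
theorem X_pow_dvd_scaleHom_iff [Fintype V] (s : Finset V) (f : MvPolynomial V K) (k : ℕ) :
    Polynomial.X ^ k ∣ scaleHom K (s : Set V) f ↔ ∀ u ∈ f.support, k ≤ ∑ i ∈ s, u i := by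
  rw [Polynomial.X_pow_dvd_iff]
  constructor
  · intro h u hu
    by_contra! hlt
    have := congrArg (MvPolynomial.coeff u) (h _ hlt)
    rw [coeff_scaleHom, if_pos rfl] at this
    exact MvPolynomial.mem_support_iff.1 hu this
  · intro h d hd
    ext u
    rw [coeff_scaleHom, MvPolynomial.coeff_zero]
    split_ifs with e
    · by_contra hu
      have := h u (MvPolynomial.mem_support_iff.2 hu)
      omega
    · rfl

theorem mem_span_X_image_iff_dvd [Fintype V] (s : Finset V) (f : MvPolynomial V K) :
    f ∈ Ideal.span (MvPolynomial.X '' (s : Set V)) ↔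
      Polynomial.X ∣ scaleHom K (s : Set V) f := by
  rw [← pow_one Polynomial.X, X_pow_dvd_scaleHom_iff, MvPolynomial.mem_ideal_span_X_image]
  refine forall₂_congr fun u _ => ?_
  rw [Nat.one_le_iff_ne_zero, Ne, Finset.sum_eq_zero_iff]
  simp

theorem isPrime_span_X_image [Fintype V] (s : Finset V) :
    (Ideal.span (MvPolynomial.X '' (s : Set V)) : Ideal (MvPolynomial V K)).IsPrime := by
  have hp : (Polynomial.X : Polynomial (MvPolynomial V K)) ≠ 0 := Polynomial.X_ne_zero
  have := (Ideal.span_singleton_prime hp).2 Polynomial.prime_X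
  have h2 := this.comap (scaleHom K (s : Set V))
  have h3 : Ideal.span (MvPolynomial.X '' (s : Set V)) =
      Ideal.comap (scaleHom K (s : Set V)) (Ideal.span {Polynomial.X}) := by
    ext f
    rw [mem_span_X_image_iff_dvd, Ideal.mem_comap, Ideal.mem_span_singleton]
  rwa [h3]

theorem X_mem_span_X_image_iff (s : Set V) (v : V) :
    (MvPolynomial.X v : MvPolynomial V K) ∈ Ideal.span (MvPolynomial.X '' s) ↔ v ∈ s := by
  classical
  rw [MvPolynomial.mem_ideal_span_X_image]
  simp [MvPolynomial.support_X, Finsupp.single_apply]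

/-- Krull's height theorem bounds the height above; adjoining the variables one at a time gives a
strict chain of primes. -/
theorem height_span_X_image [Fintype V] (s : Finset V) :
    (Ideal.span (MvPolynomial.X '' (s : Set V)) : Ideal (MvPolynomial V K)).height =
      s.card := by
  classical
  have hprime := fun s : Finset V => isPrime_span_X_image (K := K) s
  apply le_antisymm
  · have := Ideal.height_le_card_of_mem_minimalPrimes_span (R := MvPolynomial V K)
      (s := MvPolynomial.X '' (s : Set V)) (p := Ideal.span (MvPolynomial.X '' (s : Set V)))
      (s.finite_toSet.image _) (by
        have := hprime s
        rw [Ideal.minimalPrimes_eq_subsingleton_self]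
        rfl)
    rwa [Set.ncard_image_of_injective _ (MvPolynomial.X_injective),
      Set.ncard_coe_finset] at this
  · induction s using Finset.induction_on with
    | empty => simp
    | insert v s hv ih =>
      rw [Finset.card_insert_of_notMem hv, Nat.cast_add, Nat.cast_one]
      refine le_trans (by gcongr) (Order.add_one_le_of_lt
        (Ideal.height_strict_mono_of_isPrime_of_isPrime (lt_of_le_of_ne
        (Ideal.span_mono (Set.image_mono (Finset.coe_subset.2 (Finset.subset_insert v s)))) ?_)))
      intro h
      have h1 := (X_mem_span_X_image_iff (K := K) ((insert v s : Finset V) : Set V) v).2 (by simp)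
      rw [← h, X_mem_span_X_image_iff] at h1
      exact hv h1

end VariableIdeals

/-! ### Symbolic powers of the cover ideal -/

section SymbolicPowers

theorem mem_symbolicPower_iff {R : Type*} [CommRing R] (I : Ideal R) (k : ℕ) (x : R) :
    x ∈ symbolicPower I k ↔ ∀ P ∈ I.minimalPrimes, ∃ s, s ∉ P ∧ s * x ∈ I ^ k := by
  simp only [symbolicPower, Ideal.mem_iInf, Ideal.mem_comap]
  constructor
  · intro h P hP
    have : P.IsPrime := hP.1.1
    obtain ⟨s, hs, h⟩ := (IsLocalization.algebraMap_mem_map_algebraMap_iff P.primeCompl _ _ _).1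
      (h ⟨⟨P, this⟩, hP⟩)
    exact ⟨s, hs, h⟩
  · rintro h ⟨⟨P, hP'⟩, hP⟩
    obtain ⟨s, hs, h⟩ := h P hP
    exact (IsLocalization.algebraMap_mem_map_algebraMap_iff P.primeCompl _ _ _).2 ⟨s, hs, h⟩

variable {V : Type*} {G : SimpleGraph V} {K : Type*} [Field K]

open Classical in
theorem span_pair_eq (i j : V) :
    (Ideal.span {MvPolynomial.X i, MvPolynomial.X j} : Ideal (MvPolynomial V K)) =
      Ideal.span (MvPolynomial.X '' (({i, j} : Finset V) : Set V)) := by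
  simp [Set.image_pair]

theorem coverIdeal_le {i j : V} (hij : G.Adj i j) :
    coverIdeal K G ≤ Ideal.span {MvPolynomial.X i, MvPolynomial.X j} :=
  iInf_le (fun e : {e : V × V // G.Adj e.1 e.2} =>
    (Ideal.span {MvPolynomial.X e.1.1, MvPolynomial.X e.1.2} : Ideal (MvPolynomial V K)))
    ⟨(i, j), hij⟩

theorem X_mem_span_pair_iff {i j v : V} :
    (MvPolynomial.X v : MvPolynomial V K) ∈
      Ideal.span {MvPolynomial.X i, MvPolynomial.X j} ↔ v = i ∨ v = j := by
  classical
  rw [span_pair_eq, X_mem_span_X_image_iff]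
  simp

variable [Fintype V]

theorem isPrime_span_pair (i j : V) :
    (Ideal.span {MvPolynomial.X i, MvPolynomial.X j} : Ideal (MvPolynomial V K)).IsPrime := by
  rw [span_pair_eq]
  exact isPrime_span_X_image _

theorem exists_span_pair_le {P : Ideal (MvPolynomial V K)} (hP : P.IsPrime)
    (h : coverIdeal K G ≤ P) : ∃ i j, G.Adj i j ∧
      Ideal.span {MvPolynomial.X i, MvPolynomial.X j} ≤ P := by
  classical
  rw [coverIdeal, ← Finset.inf_univ_eq_iInf, hP.inf_le'] at h
  obtain ⟨⟨⟨i, j⟩, hij⟩, -, h⟩ := h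
  exact ⟨i, j, hij, h⟩

theorem mem_minimalPrimes_coverIdeal_iff {P : Ideal (MvPolynomial V K)} :
    P ∈ (coverIdeal K G).minimalPrimes ↔
      ∃ i j, G.Adj i j ∧ P = Ideal.span {MvPolynomial.X i, MvPolynomial.X j} := by
  constructor
  · rintro ⟨⟨hP, hle⟩, hmin⟩
    obtain ⟨i, j, hij, h⟩ := exists_span_pair_le hP hle
    exact ⟨i, j, hij, le_antisymm (hmin ⟨isPrime_span_pair i j, coverIdeal_le hij⟩ h) h⟩
  · rintro ⟨i, j, hij, rfl⟩
    refine ⟨⟨isPrime_span_pair i j, coverIdeal_le hij⟩, fun Q ⟨hQ, hle⟩ hQP => ?_⟩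
    obtain ⟨i', j', hij', h⟩ := exists_span_pair_le hQ hle
    have hi := X_mem_span_pair_iff.1 (hQP (h (Ideal.subset_span (Set.mem_insert _ _))))
    have hj := X_mem_span_pair_iff.1
      (hQP (h (Ideal.subset_span (Set.mem_insert_of_mem _ rfl))))
    have hne := hij'.ne
    refine le_trans ?_ h
    rcases hi with rfl | rfl <;> rcases hj with rfl | rfl
    · exact absurd rfl hne
    · exact le_rfl
    · rw [Set.pair_comm]
    · exact absurd rfl hne

/-- Locally at `(x_i, x_j)` only the degree in these two variables matters: `scaleHom` turns
membership in the symbolic power into divisibility by `X ^ k`, and explicit multipliers give the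
converse. -/
theorem mem_symbolicPower_coverIdeal_iff {k : ℕ} {f : MvPolynomial V K} :
    f ∈ symbolicPower (coverIdeal K G) k ↔
      ∀ u ∈ f.support, ∀ i j, G.Adj i j → k ≤ u i + u j := by
  classical
  have key : f ∈ symbolicPower (coverIdeal K G) k ↔ ∀ i j, G.Adj i j →
      ∃ s, s ∉ (Ideal.span {MvPolynomial.X i, MvPolynomial.X j} : Ideal (MvPolynomial V K)) ∧
        s * f ∈ coverIdeal K G ^ k := by
    rw [mem_symbolicPower_iff]
    constructor
    · intro h i j hij
      exact h _ (mem_minimalPrimes_coverIdeal_iff.2 ⟨i, j, hij, rfl⟩)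
    · intro h P hP
      obtain ⟨i, j, hij, rfl⟩ := mem_minimalPrimes_coverIdeal_iff.1 hP
      exact h i j hij
  constructor
  · intro hf u hu i j hij
    obtain ⟨s, hs, hsf⟩ := key.1 hf i j hij
    rw [span_pair_eq, mem_span_X_image_iff_dvd] at hs
    have hle : coverIdeal K G ≤ Ideal.comap (scaleHom K (({i, j} : Finset V) : Set V))
        (Ideal.span {Polynomial.X}) := by
      intro g hg
      have := coverIdeal_le hij hg
      rwa [span_pair_eq, mem_span_X_image_iff_dvd, ← Ideal.mem_span_singleton] at this
    have h1 := Ideal.le_comap_pow _ k (Ideal.pow_right_mono hle k hsf)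
    rw [Ideal.mem_comap, Ideal.span_singleton_pow, Ideal.mem_span_singleton, map_mul] at h1
    have h2 := Polynomial.prime_X.pow_dvd_of_dvd_mul_left k hs h1
    rw [X_pow_dvd_scaleHom_iff] at h2
    simpa [Finset.sum_pair hij.ne] using h2 u hu
  · intro h
    rw [f.as_sum]
    refine Ideal.sum_mem _ fun u hu => ?_
    have hu' := h u hu
    clear key
    rw [mem_symbolicPower_iff]
    intro P hP
    obtain ⟨i, j, hij, rfl⟩ := mem_minimalPrimes_coverIdeal_iff.1 hP
    -- The product of all other variables is outside the prime. Times `x_i` or `x_j` it lies in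
    -- `J(G)`, because the vertices other than one end of `{i, j}` form a vertex cover.
    set s : MvPolynomial V K := ∏ v ∈ Finset.univ \ {i, j}, MvPolynomial.X v with hs
    have hprime := isPrime_span_pair (K := K) i j
    have hsP : s ∉ (Ideal.span {MvPolynomial.X i, MvPolynomial.X j} :
        Ideal (MvPolynomial V K)) := by
      rw [hs, Ideal.IsPrime.prod_mem_iff]
      simp [X_mem_span_pair_iff]
    have hmem : ∀ v, v = i ∨ v = j → s * MvPolynomial.X v ∈ coverIdeal K G := by
      intro v hv
      rw [coverIdeal, Ideal.mem_iInf]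
      rintro ⟨⟨i', j'⟩, h'⟩
      have out : ∀ w, w ≠ i → w ≠ j → (w = i' ∨ w = j') → s * MvPolynomial.X v ∈
          (Ideal.span {MvPolynomial.X i', MvPolynomial.X j'} : Ideal (MvPolynomial V K)) := by
        intro w h1 h2 h3
        refine Ideal.mul_mem_right _ _ (Ideal.mem_of_dvd _ ?_ (X_mem_span_pair_iff.2 h3))
        exact Finset.dvd_prod_of_mem _ (by simp [h1, h2])
      by_cases h1 : i' = i ∨ i' = j
      · by_cases h2 : j' = i ∨ j' = j
        · refine Ideal.mul_mem_left _ _ (X_mem_span_pair_iff.2 ?_)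
          have := h'.ne
          grind
        · push Not at h2
          exact out j' h2.1 h2.2 (Or.inr rfl)
      · push Not at h1
        exact out i' h1.1 h1.2 (Or.inl rfl)
    -- One copy of `s` goes to each factor `x_i` or `x_j`, giving `u i + u j ≥ k` factors in `J(G)`.
    refine ⟨s ^ (u i + u j), fun hc => hsP (hprime.mem_of_pow_mem _ hc), ?_⟩
    have hdvd : (MvPolynomial.X i ^ u i * MvPolynomial.X j ^ u j : MvPolynomial V K) ∣
        MvPolynomial.monomial u (MvPolynomial.coeff u f) := by
      rw [MvPolynomial.monomial_eq, Finsupp.prod_fintype _ _ (by simp)]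
      refine Dvd.dvd.mul_left ?_ _
      rw [← Finset.prod_pair (f := fun v => (MvPolynomial.X v ^ u v : MvPolynomial V K)) hij.ne]
      exact Finset.prod_dvd_prod_of_subset _ _ _ (Finset.subset_univ _)
    refine Ideal.pow_le_pow_right (hu' i j hij) ?_
    refine Ideal.mem_of_dvd _ (mul_dvd_mul_left _ hdvd) ?_
    have : s ^ (u i + u j) * (MvPolynomial.X i ^ u i * MvPolynomial.X j ^ u j) =
        (s * MvPolynomial.X i) ^ u i * (s * MvPolynomial.X j) ^ u j := by ring
    rw [this, pow_add]
    exact Ideal.mul_mem_mul (Ideal.pow_mem_pow (hmem i (Or.inl rfl)) _)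
      (Ideal.pow_mem_pow (hmem j (Or.inr rfl)) _)

end SymbolicPowers

/-! ### The basic covers algebra -/

section FiberCone

open MvPolynomial in
theorem homogeneousComponent_mul_of_le {V K : Type*} [CommSemiring K] {p q : MvPolynomial V K}
    {d e : ℕ} (hp : ∀ u ∈ p.support, d ≤ u.degree) (hq : ∀ u ∈ q.support, e ≤ u.degree) :
    homogeneousComponent (d + e) (p * q) =
      homogeneousComponent d p * homogeneousComponent e q := by
  classical
  ext u
  have hite : ∀ (c : Prop) [Decidable c] (f : (V →₀ ℕ) × (V →₀ ℕ) → K)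
      (s : Finset ((V →₀ ℕ) × (V →₀ ℕ))),
      (if c then ∑ x ∈ s, f x else 0) = ∑ x ∈ s, if c then f x else 0 := by
    intro c _ f s
    split_ifs <;> simp
  rw [coeff_homogeneousComponent, coeff_mul, coeff_mul, hite]
  refine Finset.sum_congr rfl ?_
  rintro ⟨v, w⟩ h
  rw [Finset.HasAntidiagonal.mem_antidiagonal] at h
  have hdeg : u.degree = v.degree + w.degree := by rw [← h, map_add]
  rw [coeff_homogeneousComponent, coeff_homogeneousComponent]
  dsimp only
  by_cases hv : coeff v p = 0
  · simp [hv]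
  by_cases hw : coeff w q = 0
  · simp [hw]
  have h1 := hp v (mem_support_iff.2 hv)
  have h2 := hq w (mem_support_iff.2 hw)
  by_cases e1 : v.degree = d <;> by_cases e2 : w.degree = e <;>
    (simp [e1, e2, hdeg]; try omega)

variable {V : Type*} {G : SimpleGraph V} {K : Type*} [Field K]

/-- The part of degree `k * r` in each coefficient of index `k`. -/
noncomputable def lowPart (r : ℕ) (f : Polynomial (MvPolynomial V K)) :
    Polynomial (MvPolynomial V K) :=
  f.sum fun k c => Polynomial.monomial k (MvPolynomial.homogeneousComponent (k * r) c)

theorem coeff_lowPart (r : ℕ) (f : Polynomial (MvPolynomial V K)) (k : ℕ) :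
    (lowPart r f).coeff k = MvPolynomial.homogeneousComponent (k * r) (f.coeff k) := by
  rw [lowPart, Polynomial.sum, Polynomial.finsetSum_coeff]
  simp only [Polynomial.coeff_monomial]
  rw [Finset.sum_ite_eq']
  split_ifs with h
  · rfl
  · rw [Polynomial.notMem_support_iff.1 h, map_zero]

/-- A `k`-cover is reducible if it stays a `k`-cover after one of its entries is decreased. -/
def IsReducible (G : SimpleGraph V) (k : ℕ) (u : V →₀ ℕ) : Prop :=
  ∃ l, u l ≠ 0 ∧ ∀ j, G.Adj l j → k + 1 ≤ u l + u j

/-- This needs `k ≥ 1`: for `k = 0` reducible just means nonzero, so the zero vector, which is not a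
cover but represents the unit of the algebra, is irreducible. -/
theorem isBasicCover_iff_not_isReducible [Nonempty V] (hG : ∀ v : V, ¬ G.IsIsolated v) {k : ℕ}
    (hk : 1 ≤ k) {u : V →₀ ℕ} (hu : ∀ i j, G.Adj i j → k ≤ u i + u j) :
    IsBasicCover G k u ↔ ¬ IsReducible G k u := by
  rw [isBasicCover_iff hG hk, and_iff_right hu, IsReducible]
  push Not
  refine forall_congr' fun i => imp_congr Nat.pos_iff_ne_zero (exists_congr fun j => ?_)
  refine and_congr_right fun hij => ?_
  have := hu i j hij
  omega

theorem exists_add_of_mem_support_coeff_mul {f g : Polynomial (MvPolynomial V K)} {k : ℕ}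
    {u : V →₀ ℕ} (hu : u ∈ ((f * g).coeff k).support) : ∃ i j v w, i + j = k ∧ v + w = u ∧
      v ∈ (f.coeff i).support ∧ w ∈ (g.coeff j).support := by
  classical
  rw [MvPolynomial.mem_support_iff, Polynomial.coeff_mul, MvPolynomial.coeff_sum] at hu
  obtain ⟨⟨i, j⟩, hij, h⟩ := Finset.exists_ne_zero_of_sum_ne_zero hu
  rw [MvPolynomial.coeff_mul] at h
  obtain ⟨⟨v, w⟩, hvw, h⟩ := Finset.exists_ne_zero_of_sum_ne_zero h
  exact ⟨i, j, v, w, Finset.HasAntidiagonal.mem_antidiagonal.1 hij,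
    Finset.HasAntidiagonal.mem_antidiagonal.1 hvw,
    MvPolynomial.mem_support_iff.2 (left_ne_zero_of_mul h),
    MvPolynomial.mem_support_iff.2 (right_ne_zero_of_mul h)⟩

variable [Fintype V]

theorem coeff_support_of_mem (f : symbolicReesAlgebra (coverIdeal K G)) {k : ℕ} {u : V →₀ ℕ}
    (hu : u ∈ ((f : Polynomial (MvPolynomial V K)).coeff k).support) {i j : V}
    (hij : G.Adj i j) : k ≤ u i + u j :=
  mem_symbolicPower_coverIdeal_iff.1 (f.2 k) u hu i j hij

theorem monomial_mem_symbolicReesAlgebra {k : ℕ} {u : V →₀ ℕ}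
    (hu : ∀ i j, G.Adj i j → k ≤ u i + u j) (c : K) :
    Polynomial.monomial k (MvPolynomial.monomial u c) ∈ symbolicReesAlgebra (coverIdeal K G) := by
  intro l
  rw [Polynomial.coeff_monomial]
  split_ifs with h
  · subst h
    refine mem_symbolicPower_coverIdeal_iff.2 fun w hw => ?_
    rw [Finset.mem_singleton.1 (MvPolynomial.support_monomial_subset hw)]
    exact hu
  · exact Ideal.zero_mem _

/-- A cover is reducible exactly when its monomial is a variable times the monomial of another
`k`-cover, and adding any cover keeps it reducible. -/
theorem mem_map_irrelevantIdeal_iff (f : symbolicReesAlgebra (coverIdeal K G)) :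
    f ∈ (irrelevantIdeal K V).map
        (algebraMap (MvPolynomial V K) (symbolicReesAlgebra (coverIdeal K G))) ↔
      ∀ k, ∀ u ∈ ((f : Polynomial (MvPolynomial V K)).coeff k).support, IsReducible G k u := by
  classical
  constructor
  · intro hf
    rw [irrelevantIdeal, Ideal.map_span] at hf
    induction hf using Submodule.span_induction with
    | mem x hx =>
      obtain ⟨_, ⟨v, rfl⟩, rfl⟩ := hx
      intro k u hu
      have e : ((algebraMap (MvPolynomial V K) (symbolicReesAlgebra (coverIdeal K G))
          (MvPolynomial.X v) : symbolicReesAlgebra (coverIdeal K G)) :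
            Polynomial (MvPolynomial V K)) = Polynomial.C (MvPolynomial.X v) := rfl
      rw [e, Polynomial.coeff_C] at hu
      split_ifs at hu with hk
      · rw [MvPolynomial.support_X, Finset.mem_singleton] at hu
        subst hu hk
        exact ⟨v, by simp, by simp⟩
      · simp at hu
    | zero => simp
    | add x y _ _ hx hy =>
      intro k u hu
      rw [Subalgebra.coe_add, Polynomial.coeff_add] at hu
      rcases Finset.mem_union.1 (MvPolynomial.support_add hu) with h | h
      · exact hx k u h
      · exact hy k u h
    | smul r x _ hx =>
      intro k u hu
      rw [smul_eq_mul, Subalgebra.coe_mul] at hu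
      obtain ⟨i, j, v, w, rfl, rfl, hv, hw⟩ := exists_add_of_mem_support_coeff_mul hu
      obtain ⟨l, hl, h⟩ := hx j w hw
      refine ⟨l, by simp [hl], fun l' hl' => ?_⟩
      have h1 := h l' hl'
      have h2 := coeff_support_of_mem r hv hl'
      simp only [Finsupp.add_apply]
      omega
  · intro h
    set M := (irrelevantIdeal K V).map
      (algebraMap (MvPolynomial V K) (symbolicReesAlgebra (coverIdeal K G)))
    -- Passing to the image in `R[t]` lets membership be checked monomial by monomial, although the
    -- monomials are not given as elements of the subalgebra.
    let N : AddSubmonoid (Polynomial (MvPolynomial V K)) :=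
      M.toAddSubmonoid.map (symbolicReesAlgebra (coverIdeal K G)).val
    suffices hN : (f : Polynomial (MvPolynomial V K)) ∈ N by
      obtain ⟨g, hg, e⟩ := hN
      rwa [← Subtype.ext e]
    rw [(f : Polynomial (MvPolynomial V K)).as_sum_support]
    refine sum_mem fun k _ => ?_
    rw [((f : Polynomial (MvPolynomial V K)).coeff k).as_sum, map_sum]
    refine sum_mem fun u hu => ?_
    obtain ⟨l, hl, hlj⟩ := h k u hu
    have hle : Finsupp.single l 1 ≤ u := by
      rw [Finsupp.single_le_iff]; omega
    set c := MvPolynomial.coeff u ((f : Polynomial (MvPolynomial V K)).coeff k)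
    have hcov : ∀ i j, G.Adj i j →
        k ≤ (u - Finsupp.single l 1 : V →₀ ℕ) i + (u - Finsupp.single l 1 : V →₀ ℕ) j := by
      intro i j hij
      have h1 := coeff_support_of_mem f hu hij
      have hne := hij.ne
      simp only [Finsupp.tsub_apply, Finsupp.single_apply]
      split_ifs with h2 h3 h3
      · exact absurd (h2.symm.trans h3) hne
      · subst h2
        have := hlj j hij
        omega
      · subst h3
        have := hlj i hij.symm
        omega
      · omega
    refine ⟨algebraMap (MvPolynomial V K) (symbolicReesAlgebra (coverIdeal K G))
      (MvPolynomial.X l) * ⟨_, monomial_mem_symbolicReesAlgebra hcov c⟩,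
      Ideal.mul_mem_right _ _ (Ideal.mem_map_of_mem _ (Ideal.subset_span ⟨l, rfl⟩)), ?_⟩
    change Polynomial.C (MvPolynomial.X l) * Polynomial.monomial k (MvPolynomial.monomial _ c) = _
    rw [Polynomial.C_mul_monomial, MvPolynomial.X, MvPolynomial.monomial_mul, one_mul,
      add_tsub_cancel_of_le hle]

/-- Irreducible monomials in degree `k` are those of the least possible degree `k * r`. So `lowPart`
is multiplicative on the Rees algebra, kills exactly `𝔪 R_s`, and takes values in a domain. -/
theorem isDomain_basicCoversAlgebra [Nonempty V] (hG : ∀ v : V, ¬ G.IsIsolated v)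
    (h : ∀ k : ℕ, 1 ≤ k → ∀ a b : V → ℕ, IsBasicCover G k a → IsBasicCover G k b →
      norm a = norm b) : IsDomain (basicCoversAlgebra K G) := by
  classical
  obtain ⟨r, hr⟩ := exists_norm_eq_mul hG h
  have hnorm : ∀ u : V →₀ ℕ, norm u = u.degree := fun u => (Finsupp.degree_eq_sum u).symm
  have hdeg : ∀ (f : symbolicReesAlgebra (coverIdeal K G)) (k : ℕ),
      ∀ u ∈ ((f : Polynomial (MvPolynomial V K)).coeff k).support, k * r ≤ u.degree := by
    intro f k u hu
    rcases Nat.eq_zero_or_pos k with rfl | hk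
    · simp
    · rw [← hnorm]
      exact (hr k hk u fun i j hij => coeff_support_of_mem f hu hij).1
  have hred : ∀ (f : symbolicReesAlgebra (coverIdeal K G)) (k : ℕ),
      ∀ u ∈ ((f : Polynomial (MvPolynomial V K)).coeff k).support,
        (IsReducible G k u ↔ u.degree ≠ k * r) := by
    intro f k u hu
    rcases Nat.eq_zero_or_pos k with rfl | hk
    · rw [zero_mul, Ne, Finsupp.degree_eq_zero_iff, ← Ne, Finsupp.ne_iff, IsReducible]
      refine exists_congr fun l => and_iff_left_of_imp fun hl j _ => ?_
      change u l ≠ 0 at hl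
      omega
    · have hcov : ∀ i j, G.Adj i j → k ≤ u i + u j :=
        fun i j hij => coeff_support_of_mem f hu hij
      rw [← not_iff_comm.1 (isBasicCover_iff_not_isReducible hG hk hcov).symm,
        (hr k hk u hcov).2, hnorm]
  have hlow : ∀ f : symbolicReesAlgebra (coverIdeal K G), f ∈ (irrelevantIdeal K V).map
      (algebraMap (MvPolynomial V K) (symbolicReesAlgebra (coverIdeal K G))) ↔
        lowPart r (f : Polynomial (MvPolynomial V K)) = 0 := by
    intro f
    rw [mem_map_irrelevantIdeal_iff, Polynomial.ext_iff]
    refine forall_congr' fun k => ?_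
    rw [coeff_lowPart, Polynomial.coeff_zero, MvPolynomial.ext_iff]
    refine forall_congr' fun u => ?_
    rw [MvPolynomial.coeff_homogeneousComponent, MvPolynomial.coeff_zero]
    constructor
    · intro hu
      split_ifs with hd
      · by_contra hne
        have hmem := MvPolynomial.mem_support_iff.2 hne
        exact (hred f k u hmem).1 (hu hmem) hd
      · rfl
    · intro hz hu
      refine (hred f k u hu).2 fun hd => ?_
      rw [if_pos hd] at hz
      exact MvPolynomial.mem_support_iff.1 hu hz
  have hmul : ∀ f g : symbolicReesAlgebra (coverIdeal K G),
      lowPart r ((f * g : symbolicReesAlgebra (coverIdeal K G)) :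
        Polynomial (MvPolynomial V K)) = lowPart r (f : Polynomial (MvPolynomial V K)) *
          lowPart r (g : Polynomial (MvPolynomial V K)) := by
    intro f g
    ext1 k
    rw [coeff_lowPart, Subalgebra.coe_mul, Polynomial.coeff_mul, Polynomial.coeff_mul, map_sum]
    refine Finset.sum_congr rfl fun x hx => ?_
    rw [coeff_lowPart, coeff_lowPart, ← Finset.HasAntidiagonal.mem_antidiagonal.1 hx, add_mul,
      homogeneousComponent_mul_of_le (hdeg f _) (hdeg g _)]
  rw [Ideal.Quotient.isDomain_iff_prime]
  refine ⟨?_, fun {f g} hfg => ?_⟩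
  · rw [Ideal.ne_top_iff_one, mem_map_irrelevantIdeal_iff]
    intro h1
    obtain ⟨l, hl, -⟩ := h1 0 0 (by
      rw [MvPolynomial.mem_support_iff, Subalgebra.coe_one, Polynomial.coeff_one_zero,
        MvPolynomial.coeff_zero_one]
      exact one_ne_zero)
    exact hl rfl
  · rw [hlow, hmul, mul_eq_zero] at hfg
    rwa [hlow, hlow]

/-- Monomials of basic covers are nonzero in the quotient, hence so is their product, which is the
monomial of the sum. -/
theorem isDomainGraph_of_isDomain [Nonempty V] (hG : ∀ v : V, ¬ G.IsIsolated v)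
    (h : IsDomain (basicCoversAlgebra K G)) : IsDomainGraph G := by
  classical
  rw [Ideal.Quotient.isDomain_iff_prime] at h
  intro s t hst a b ha hb
  let m : (V → ℕ) → V →₀ ℕ := Finsupp.equivFunOnFinite.symm
  let x : (k : ℕ) → (c : V → ℕ) → IsBasicCover G k c → symbolicReesAlgebra (coverIdeal K G) :=
    fun k c hc => ⟨Polynomial.monomial k (MvPolynomial.monomial (m c) 1),
      monomial_mem_symbolicReesAlgebra hc.1.2 1⟩
  have hx : ∀ k c (hc : IsBasicCover G k c), 1 ≤ k → x k c hc ∉ (irrelevantIdeal K V).map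
      (algebraMap (MvPolynomial V K) (symbolicReesAlgebra (coverIdeal K G))) := by
    intro k c hc hk hmem
    rw [mem_map_irrelevantIdeal_iff] at hmem
    exact (isBasicCover_iff_not_isReducible hG hk (u := m c) hc.1.2).1 hc
      (hmem k (m c) (by simp [x]))
  have hprod : (∏ p, x 1 (a p) (ha p)) * ∏ q, x 2 (b q) (hb q) ∉ (irrelevantIdeal K V).map
      (algebraMap (MvPolynomial V K) (symbolicReesAlgebra (coverIdeal K G))) := by
    rw [h.mul_mem_iff_mem_or_mem, Ideal.IsPrime.prod_mem_iff, Ideal.IsPrime.prod_mem_iff]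
    rintro (⟨p, -, hp⟩ | ⟨q, -, hq⟩)
    · exact hx _ _ (ha p) le_rfl hp
    · exact hx _ _ (hb q) one_le_two hq
  have hval : (((∏ p, x 1 (a p) (ha p)) * ∏ q, x 2 (b q) (hb q) :
      symbolicReesAlgebra (coverIdeal K G)) : Polynomial (MvPolynomial V K)) =
        Polynomial.monomial (s + 2 * t)
          (MvPolynomial.monomial (m (∑ p, a p + ∑ q, b q)) 1) := by
    have hm : m (∑ p, a p + ∑ q, b q) = ∑ p, m (a p) + ∑ q, m (b q) := by
      ext v
      simp [m]
    rw [Subalgebra.coe_mul, SubmonoidClass.coe_finsetProd, SubmonoidClass.coe_finsetProd, hm, add_comm s,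
      ← Polynomial.C_mul_X_pow_eq_monomial]
    simp only [x, ← Polynomial.C_mul_X_pow_eq_monomial, Finset.prod_mul_distrib, ← map_prod,
      ← MvPolynomial.monomial_sum_one, Finset.prod_const, Finset.card_univ, Fintype.card_fin]
    rw [← one_mul (1 : K), ← MvPolynomial.monomial_mul, one_mul, Polynomial.C_mul]
    ring
  rw [mem_map_irrelevantIdeal_iff, hval] at hprod
  push Not at hprod
  obtain ⟨k, u, hu, hred⟩ := hprod
  rw [Polynomial.coeff_monomial] at hu
  split_ifs at hu with hk
  · subst hk
    obtain rfl := Finset.mem_singleton.1 (MvPolynomial.support_monomial_subset hu)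
    refine (isBasicCover_iff_not_isReducible hG (by omega)
      (u := m (∑ p, a p + ∑ q, b q)) ?_).2 hred
    intro i j hij
    refine coeff_support_of_mem ((∏ p, x 1 (a p) (ha p)) * ∏ q, x 2 (b q) (hb q)) ?_ hij
    rw [hval, Polynomial.coeff_monomial, if_pos rfl]
    exact hu
  · simp at hu

end FiberCone

/-! ### Associated primes of the edge ideal -/

section EdgeIdeal

open MvPolynomial

variable {V : Type*} {G : SimpleGraph V} {K : Type*} [Field K]

theorem mem_edgeIdeal_iff {f : MvPolynomial V K} :
    f ∈ edgeIdeal K G ↔ ∀ u ∈ f.support, ∃ i j, G.Adj i j ∧ u i ≠ 0 ∧ u j ≠ 0 := by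
  classical
  have : {f : MvPolynomial V K | ∃ i j : V, G.Adj i j ∧ f = X i * X j} =
      (fun s => monomial s (1 : K)) ''
        {s | ∃ i j, G.Adj i j ∧ s = Finsupp.single i 1 + Finsupp.single j 1} := by
    ext f
    simp only [Set.mem_ofPred_eq, Set.mem_image]
    constructor
    · rintro ⟨i, j, hij, rfl⟩
      exact ⟨_, ⟨i, j, hij, rfl⟩, by simp [X, monomial_mul]⟩
    · rintro ⟨_, ⟨i, j, hij, rfl⟩, rfl⟩
      exact ⟨i, j, hij, by simp [X, monomial_mul]⟩
  rw [edgeIdeal, this, mem_ideal_span_monomial_image]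
  refine forall₂_congr fun u _ => ?_
  constructor
  · rintro ⟨_, ⟨i, j, hij, rfl⟩, hle⟩
    have h1 := hle i
    have h2 := hle j
    simp at h1 h2
    exact ⟨i, j, hij, by omega, by omega⟩
  · rintro ⟨i, j, hij, hi, hj⟩
    refine ⟨_, ⟨i, j, hij, rfl⟩, fun v => ?_⟩
    have hne := hij.ne
    simp only [Finsupp.add_apply, Finsupp.single_apply]
    split_ifs with h1 h2 h2
    · exact absurd (h1.trans h2.symm) hne
    · subst h1; omega
    · subst h2; omega
    · omega

variable [Fintype V]

open Classical in
/-- The prime ideal generated by the variables in the vertex cover given by `a`. -/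
noncomputable def coverPrime (K : Type*) [Field K] (a : V → ℕ) : Ideal (MvPolynomial V K) :=
  Ideal.span (X '' ((Finset.univ.filter fun i => a i = 1 : Finset V) : Set V))

theorem isPrime_coverPrime (a : V → ℕ) : (coverPrime K a).IsPrime :=
  isPrime_span_X_image _

theorem height_coverPrime (a : V → ℕ) : (coverPrime K a).height = numOnes a := by
  rw [coverPrime, height_span_X_image, numOnes]

theorem X_mem_coverPrime_iff {a : V → ℕ} {v : V} :
    (X v : MvPolynomial V K) ∈ coverPrime K a ↔ a v = 1 := by
  rw [coverPrime, X_mem_span_X_image_iff]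
  simp

variable [Nonempty V]

theorem edgeIdeal_le_coverPrime (hG : ∀ v : V, ¬ G.IsIsolated v) {a : V → ℕ}
    (ha : IsBasicCover G 1 a) : edgeIdeal K G ≤ coverPrime K a := by
  refine Ideal.span_le.2 ?_
  rintro _ ⟨i, j, hij, rfl⟩
  have h1 := ha.1.2 i j hij
  have h2 := ha.le_one hG i
  have h3 := ha.le_one hG j
  by_cases hi : a i = 1
  · exact Ideal.mul_mem_right _ _ (X_mem_coverPrime_iff.2 hi)
  · exact Ideal.mul_mem_left _ _ (X_mem_coverPrime_iff.2 (by omega))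

/-- The variables of a monomial outside `I(G)` form an independent set, so some basic 1-cover
vanishes on it and its prime misses the monomial. -/
theorem mem_edgeIdeal_iff_forall_coverPrime (hG : ∀ v : V, ¬ G.IsIsolated v)
    {f : MvPolynomial V K} :
    f ∈ edgeIdeal K G ↔ ∀ a, IsBasicCover G 1 a → f ∈ coverPrime K a := by
  refine ⟨fun hf a ha => edgeIdeal_le_coverPrime hG ha hf, fun h => ?_⟩
  rw [mem_edgeIdeal_iff]
  intro u hu
  by_contra! hno
  obtain ⟨a, ha, h0⟩ := exists_isBasicCover_eq_zero hG {v | u v ≠ 0}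
    (fun v hv w hw hvw => hw (hno v w hvw hv))
  have hf := h a ha
  rw [coverPrime, mem_ideal_span_X_image] at hf
  obtain ⟨i, hi, hui⟩ := hf u hu
  have := h0 i hui
  simp [this] at hi

theorem mem_colon_singleton_mk_iff {R : Type*} [CommRing R] {I : Ideal R} {f r : R} :
    r ∈ Submodule.colon (⊥ : Submodule R (R ⧸ I)) {Ideal.Quotient.mk I f} ↔ r * f ∈ I := by
  rw [Submodule.mem_colon_singleton, Submodule.mem_bot, ← Ideal.Quotient.eq_zero_iff_mem, map_mul]
  rfl

theorem mem_associatedPrimes_edgeIdeal_iff (hG : ∀ v : V, ¬ G.IsIsolated v)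
    {P : Ideal (MvPolynomial V K)} :
    P ∈ associatedPrimes (MvPolynomial V K) (MvPolynomial V K ⧸ edgeIdeal K G) ↔
      ∃ a, IsBasicCover G 1 a ∧ P = coverPrime K a := by
  classical
  rw [AssociatedPrimes.mem_iff, isAssociatedPrime_iff]
  constructor
  · rintro ⟨hP, x, hx⟩
    obtain ⟨f, rfl⟩ := Ideal.Quotient.mk_surjective x
    have hmem : ∀ r, r ∈ P ↔ r * f ∈ edgeIdeal K G := fun r => by
      rw [hx, mem_colon_singleton_mk_iff]
    have hfin : (Set.ofPred fun a => IsBasicCover G 1 a ∧ f ∉ coverPrime K a).Finite := by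
      refine (Set.finite_Iic (fun _ : V => 1)).subset fun a ha => ?_
      exact fun v => ha.1.le_one hG v
    -- Since `I(G)` is the intersection of the cover primes, whatever lies in all those not
    -- containing `f` multiplies `f` into `I(G)`; a prime containing this finite intersection
    -- contains one of them.
    have hle : hfin.toFinset.inf (fun a => coverPrime K a) ≤ P := by
      intro r hr
      rw [hmem, mem_edgeIdeal_iff_forall_coverPrime hG]
      intro a ha
      by_cases hfa : f ∈ coverPrime K a
      · exact Ideal.mul_mem_left _ _ hfa
      · refine Ideal.mul_mem_right _ _ ?_
        exact Finset.inf_le (f := fun a => coverPrime K a) (hfin.mem_toFinset.2 ⟨ha, hfa⟩) hr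
    obtain ⟨a, ha, hle⟩ := hP.inf_le'.1 hle
    obtain ⟨ha, hfa⟩ := hfin.mem_toFinset.1 ha
    refine ⟨a, ha, le_antisymm (fun r hr => ?_) hle⟩
    exact ((isPrime_coverPrime a).mem_or_mem
      (edgeIdeal_le_coverPrime hG ha ((hmem r).1 hr))).resolve_right hfa
  · rintro ⟨a, ha, rfl⟩
    have hprime := isPrime_coverPrime (K := K) a
    -- The product of the variables off the cover is the witness: each `x_i` in the cover has a
    -- tight edge to some `j` with `a j = 0`, so `x_i * w` lies in `I(G)`.
    set w : MvPolynomial V K := ∏ v ∈ Finset.univ.filter fun v => a v = 0, X v with hw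
    refine ⟨hprime, Ideal.Quotient.mk _ w, ?_⟩
    ext r
    rw [mem_colon_singleton_mk_iff]
    constructor
    · intro hr
      have hle : coverPrime K a ≤
          Submodule.comap (LinearMap.mulRight (MvPolynomial V K) w) (edgeIdeal K G) := by
        refine Ideal.span_le.2 ?_
        rintro _ ⟨i, hi, rfl⟩
        have hi : a i = 1 := by simpa using hi
        obtain ⟨j, hij, e⟩ := ((isBasicCover_iff hG le_rfl).1 ha).2 i (by omega)
        change X i * w ∈ edgeIdeal K G
        refine Ideal.mem_of_dvd _ (mul_dvd_mul_left _ (Finset.dvd_prod_of_mem _ ?_))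
          (Ideal.subset_span ⟨i, j, hij, rfl⟩)
        simp
        omega
      exact hle hr
    · intro hr
      refine (hprime.mem_or_mem (edgeIdeal_le_coverPrime hG ha hr)).resolve_right ?_
      rw [hw, Ideal.IsPrime.prod_mem_iff]
      simp only [Finset.mem_filter, Finset.mem_univ, true_and, X_mem_coverPrime_iff]
      rintro ⟨i, h0, h1⟩
      omega

theorem isUnmixedIdeal_edgeIdeal_iff (hG : ∀ v : V, ¬ G.IsIsolated v) :
    IsUnmixedIdeal (edgeIdeal K G) ↔ IsUnmixedGraph G := by
  simp only [IsUnmixedIdeal, mem_associatedPrimes_edgeIdeal_iff hG]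
  constructor
  · intro h a b ha hb
    have := h _ ⟨a, ha, rfl⟩ _ ⟨b, hb, rfl⟩
    rw [height_coverPrime, height_coverPrime] at this
    exact_mod_cast this
  · rintro h _ ⟨a, ha, rfl⟩ _ ⟨b, hb, rfl⟩
    rw [height_coverPrime, height_coverPrime, h a b ha hb]

end EdgeIdeal

end BasicCovers

/-! ### The equivalences -/

theorem theorem2p9 {V : Type*} [Fintype V] [Nonempty V] (G : SimpleGraph V)
    (hG : ∀ v : V, ¬ G.IsIsolated v) (K : Type*) [Field K] :
    List.TFAE
      [ BasicCovers.MSC G,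
        ∀ k : ℕ, 1 ≤ k → ∀ a : V → ℕ, BasicCovers.IsBasicCover G k a →
          (BasicCovers.norm a : ℚ) = (k : ℚ) * (Fintype.card V : ℚ) / 2,
        ∀ k : ℕ, 1 ≤ k → ∀ a b : V → ℕ, BasicCovers.IsBasicCover G k a →
          BasicCovers.IsBasicCover G k b → BasicCovers.norm a = BasicCovers.norm b,
        BasicCovers.IsUnmixedGraph G ∧ BasicCovers.IsDomainGraph G,
        IsDomain (BasicCovers.basicCoversAlgebra K G) ∧
          BasicCovers.IsUnmixedIdeal (BasicCovers.edgeIdeal K G),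
        ∀ C : (BasicCovers.zeroOneGraph G).ConnectedComponent, ∃ a : ℕ, 1 ≤ a ∧
          Nonempty (C.toSimpleGraph ≃g completeBipartiteGraph (Fin a) (Fin a)),
        ∃ M : (BasicCovers.zeroOneGraph G).Subgraph, M.IsPerfectMatching,
        (∃ M : G.Subgraph, M.IsPerfectMatching) ∧
          ∀ a : V → ℕ, BasicCovers.IsBasicCover G 1 a →
            (BasicCovers.numOnes a : ℚ) = (Fintype.card V : ℚ) / 2 ] := by
  open BasicCovers in
  tfae_have 1 → 2 := fun h k hk a ha => h.norm_eq hG hk ha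
  tfae_have 2 → 3 := fun h k hk a b ha hb => by
    exact_mod_cast (h k hk a ha).trans (h k hk b hb).symm
  tfae_have 3 → 5 := fun h => ⟨isDomain_basicCoversAlgebra hG h,
    (isUnmixedIdeal_edgeIdeal_iff hG).2 (isUnmixedGraph_and_isDomainGraph hG h).1⟩
  tfae_have 5 → 4 := fun h =>
    ⟨(isUnmixedIdeal_edgeIdeal_iff hG).1 h.2, isDomainGraph_of_isDomain hG h.1⟩
  tfae_have 4 → 6 := fun h => exists_iso_completeBipartiteGraph hG h.1 h.2
  tfae_have 6 → 7 := exists_isPerfectMatching_of_iso_completeBipartiteGraph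
  tfae_have 7 → 1 := fun h =>
    (msc_iff hG).2 ((exists_isPerfectMatching_zeroOneGraph_iff hG).1 h)
  tfae_have 1 → 8 := fun h => ⟨h.exists_isPerfectMatching hG, fun a ha => by
    rw [numOnes_eq_norm hG ha, h.norm_eq hG le_rfl ha, Nat.cast_one, one_mul]⟩
  tfae_have 8 → 7 := fun h => exists_isPerfectMatching_zeroOneGraph hG h.1 h.2
  tfae_finish
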